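/- Let $k$ be a field, $A$ an associative unital $k$-algebra, $B$ a commutative unital $k$-algebra, and $\varepsilon:B\to A$ a morphism of $k$-algebras with image in the centre of $A$. For $n\ge 0$ let $C^n=C^n((A,B,\varepsilon);A)=\mathrm{Hom}_k(A^{\otimes n}\otimes B^{\otimes n(n-1)/2},A)$, and $C^n=0$ for $n<0$. Write an elementary tensor as an upper triangular matrix $T$ with diagonal entries $a_1,\dots,a_n\in A$ and entries $b_{s,t}\in B$ for $s<t$; let $T^{i}_{i+n}$ be the submatrix on the indices $i+1,\dots,i+n$. Let $\delta_n^\varepsilon:C^n\to C^{n+1}$ be $$\delta_n^\varepsilon(f)(T)=a_1\,\varepsilon\Big(\prod_{l=2}^{n+1}b_{1,l}\Big)f(T^1_{n+1})+\sum_{i=1}^{n}(-1)^i f(M_{i,i+1})+(-1)^{n+1}f(T^0_n)\,a_{n+1}\,\varepsilon\Big(\prod_{l=1}^{n}b_{l,n+1}\Big),$$ where $M_{i,i+1}$ arises from $T$ by multiplying rows $i,i+1$ and columns $i,i+1$ entrywise, with new diagonal entry $\varepsilon(b_{i,i+1})a_ia_{i+1}$. Let $H^n((A,B,\varepsilon);A)=\ker\delta^\varepsilon_n/\mathrm{im}\,\delta^\varepsilon_{n-1}$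 be the secondary Hochschild cohomology. For $f\in C^m$, $g\in C^n$ and $0\le i\le m-1$ define $f\circ_i g\in C^{m+n-1}$ by $(f\circ_i g)(T)=f(T')$, where $T'$ is the matrix of size $m$ obtained from $T$ by replacing the indices $i+1,\dots,i+n$ by a single index, with diagonal entry $g(T^i_{i+n})$, with the entry in row $s\le i$ equal to $\prod_{i<t\le i+n}b_{s,t}$, and with the entry in the column of an index $t>i+n$ equal to $\prod_{i<s\le i+n}b_{s,t}$ (empty products are $1$); all other entries are unchanged. Put $$f\circ g=\sum_{i=0}^{m-1}(-1)^{(n-1)i}f\circ_i g,\qquad [f,g]=f\circ g-(-1)^{(m-1)(n-1)}g\circ f .$$ Then: 1. The spaces $V_m=C^{m+1}$ ($m\in\mathbb Z$) with the operations $\circ_i:V_m\otimes V_n\to V_{m+n}$, $0\le i\le m$, form a pre-Lie system: for $f\in V_m$, $g\in V_n$, $h\in V_p$ and $0\le i\le m$, $$(f\circ_i g)\circ_j h=(f\circ_j h)\circ_{i+p}g\ \text{ if } 0\le j\le i-1,\qquad (f\circ_i g)\circ_j h=f\circ_i(g\circ_{j-i}h)\ \text{ if } i\le j\le i+n .$$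 2. The bracket of two cocycles is a cocycle, and its class depends only on the classes of the two cocycles, so that $[\cdot,\cdot]$ induces bilinear maps $H^m((A,B,\varepsilon);A)\times H^n((A,B,\varepsilon);A)\to H^{m+n-1}((A,B,\varepsilon);A)$. With $H^m$ placed in degree $m-1$, this makes $H^*((A,B,\varepsilon);A)$ a graded Lie algebra over $k$: for $x,y,z$ homogeneous of degrees $|x|,|y|,|z|$, $$[x,y]=-(-1)^{|x||y|}[y,x],\qquad [x,[y,z]]=[[x,y],z]+(-1)^{|x||y|}[y,[x,z]],$$ and moreover $[x,x]=0$ if $|x|$ is even and $[x,[x,x]]=0$ if $|x|$ is odd. -/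

import Mathlib

namespace SecHoch

/-- The positions `(i, j)`, `i < j`, of the entries `b_{i,j}` of a tensor matrix of size `n`
(rows and columns are numbered from `0`). -/
abbrev Pairs (n : ℕ) : Type := {p : Fin n × Fin n // p.1 < p.2}

section Cochains

variable (k A B : Type*) [Field k] [Ring A] [Algebra k A] [CommRing B] [Algebra k B]

/-- `Hom_k (A^{⊗ n} ⊗ B^{⊗ n(n-1)/2}, A)`, written as the space of maps that are `k`-multilinear in
the diagonal entries `a_i ∈ A` and in the entries `b_{i,j} ∈ B`, `i < j`, of a tensor matrix. -/
abbrev Cochain (n : ℕ) : Type _ :=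
  MultilinearMap k (fun _ : Fin n => A) (MultilinearMap k (fun _ : Pairs n => B) A)

variable {k A B}

/-- Separate `k`-linearity in all entries of a tensor matrix. -/
structure IsMulti (k : Type*) {A B : Type*} [Field k] [Ring A] [Algebra k A] [CommRing B]
    [Algebra k B] {n : ℕ} (F : (Fin n → A) → (Pairs n → B) → A) : Prop where
  addA : ∀ a b l x y, F (Function.update a l (x + y)) b =
    F (Function.update a l x) b + F (Function.update a l y) b
  smulA : ∀ a b l (c : k) x, F (Function.update a l (c • x)) b = c • F (Function.update a l x) b
  addB : ∀ a b t x y, F a (Function.update b t (x + y)) =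
    F a (Function.update b t x) + F a (Function.update b t y)
  smulB : ∀ a b t (c : k) x, F a (Function.update b t (c • x)) = c • F a (Function.update b t x)

/-- A cochain from a function that is linear in each entry. -/
def Cochain.ofFun {n : ℕ} (F : (Fin n → A) → (Pairs n → B) → A) (hF : IsMulti k F) :
    Cochain k A B n :=
  MultilinearMap.mk' (fun a => MultilinearMap.mk' (F a) (hF.addB a) (hF.smulB a))
    (fun a l x y => MultilinearMap.ext fun b => hF.addA a b l x y)
    (fun a l c x => MultilinearMap.ext fun b => hF.smulA a b l c x)

@[simp] theorem Cochain.ofFun_apply {n : ℕ} (F : (Fin n → A) → (Pairs n → B) → A)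
    (hF : IsMulti k F) (a : Fin n → A) (b : Pairs n → B) : Cochain.ofFun F hF a b = F a b := rfl

theorem Cochain.isMulti {n : ℕ} (f : Cochain k A B n) : IsMulti k (fun a b => f a b) where
  addA a b l x y := by simp
  smulA a b l c x := by simp
  addB a b t x y := by simp
  smulB a b t c x := by simp

theorem IsMulti.add {n : ℕ} {F G : (Fin n → A) → (Pairs n → B) → A} (hF : IsMulti k F)
    (hG : IsMulti k G) : IsMulti k (fun a b => F a b + G a b) where
  addA a b l x y := by rw [hF.addA, hG.addA]; abel
  smulA a b l c x := by rw [hF.smulA, hG.smulA, smul_add]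
  addB a b t x y := by rw [hF.addB, hG.addB]; abel
  smulB a b t c x := by rw [hF.smulB, hG.smulB, smul_add]

theorem IsMulti.neg_pow {n : ℕ} {F : (Fin n → A) → (Pairs n → B) → A} (hF : IsMulti k F)
    (e : ℕ) : IsMulti k (fun a b => (-1) ^ e * F a b) where
  addA a b l x y := by rw [hF.addA, mul_add]
  smulA a b l c x := by rw [hF.smulA, mul_smul_comm]
  addB a b t x y := by rw [hF.addB, mul_add]
  smulB a b t c x := by rw [hF.smulB, mul_smul_comm]

theorem IsMulti.sum {n : ℕ} {ι : Type*} (s : Finset ι) {F : ι → (Fin n → A) → (Pairs n → B) → A}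
    (hF : ∀ i, IsMulti k (F i)) : IsMulti k (fun a b => ∑ i ∈ s, F i a b) where
  addA a b l x y := by simp only [(hF _).addA, Finset.sum_add_distrib]
  smulA a b l c x := by simp only [(hF _).smulA, Finset.smul_sum]
  addB a b t x y := by simp only [(hF _).addB, Finset.sum_add_distrib]
  smulB a b t c x := by simp only [(hF _).smulB, Finset.smul_sum]

end Cochains

section Blocks

variable {A B : Type*}

/-- The `l`-th index of the block `{i, …, i+n-1}`. -/
def blockIdx {n r : ℕ} (i : ℕ) (h : i + n ≤ r) (l : Fin n) : Fin r := ⟨i + l, by omega⟩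

/-- The diagonal `a_i, …, a_{i+n-1}` of the sub-tensor matrix on the indices `i, …, i+n-1`. -/
def blockA {n r : ℕ} (i : ℕ) (h : i + n ≤ r) (a : Fin r → A) : Fin n → A :=
  fun l => a (blockIdx i h l)

/-- The entries `b_{k,l}` of the sub-tensor matrix on the indices `i, …, i+n-1`. -/
def blockB {n r : ℕ} (i : ℕ) (h : i + n ≤ r) (b : Pairs r → B) : Pairs n → B :=
  fun q => b ⟨(blockIdx i h q.1.1, blockIdx i h q.1.2), Nat.add_lt_add_left q.2 i⟩

/-- The monotone map that sends the block `{i, …, i+n-1}` to `i` and is injective on the rest: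
`l ↦ l` for `l < i`, and `l ↦ l + 1 - n` for `l ≥ i + n`. For `n = 0` it skips the value `i`. -/
def squash (i n l : ℕ) : ℕ := if l < i then l else if l < i + n then i else l + 1 - n

/-- The diagonal of the matrix of size `m` that results from a matrix of size `r = m + n - 1` by
contracting the block `{i, …, i+n-1}` to one row and column with diagonal entry `x`. -/
def contractA {m n r : ℕ} (h : m + n = r + 1) (i : Fin m) (x : A) (a : Fin r → A) : Fin m → A :=
  fun p => if hp : p < i then a ⟨p, by omega⟩
    else if hp' : p = i then x
    else a ⟨p + n - 1, by omega⟩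

/-- The off-diagonal part of the contracted matrix: the entry at `(p, q)` is the product of all
`b_{s,t}` whose row `s` is contracted to `p` and whose column `t` is contracted to `q`. So it is a
single entry of the old matrix if `p, q ≠ i`, the product of `b_{p,t}` over the `t` of the block if
`q = i`, and the product of `b_{s,t}` over the `s` of the block if `p = i`. -/
def contractB [CommRing B] {m r : ℕ} (n : ℕ) (i : Fin m) (b : Pairs r → B) : Pairs m → B :=
  fun q => ∏ t : Pairs r with
    squash i n t.1.1 = (q.1.1 : ℕ) ∧ squash i n t.1.2 = (q.1.2 : ℕ), b t

end Blocks

section BlockLemmas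

variable {A B : Type*}

theorem blockA_update_of_mem {n r : ℕ} (i : ℕ) (h : i + n ≤ r) (a : Fin r → A) (l : Fin n) (x : A) :
    blockA i h (Function.update a (blockIdx i h l) x) = Function.update (blockA i h a) l x := by
  funext p
  by_cases hp : p = l
  · subst hp; simp [blockA]
  · have : blockIdx i h p ≠ blockIdx i h l := by
      intro e; apply hp; simp [blockIdx, Fin.ext_iff] at e ⊢; exact e
    simp [blockA, Function.update_of_ne, hp, this]

theorem blockA_update_of_notMem {n r : ℕ} (i : ℕ) (h : i + n ≤ r) (a : Fin r → A) (l : Fin r)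
    (hl : ∀ p : Fin n, blockIdx i h p ≠ l) (x : A) :
    blockA i h (Function.update a l x) = blockA i h a := by
  funext p; simp [blockA, Function.update_of_ne (hl p)]

theorem blockB_update_of_mem {n r : ℕ} (i : ℕ) (h : i + n ≤ r) (b : Pairs r → B) (q : Pairs n)
    (t : Pairs r) (h1 : t.1.1 = blockIdx i h q.1.1) (h2 : t.1.2 = blockIdx i h q.1.2) (x : B) :
    blockB i h (Function.update b t x) = Function.update (blockB i h b) q x := by
  funext p
  by_cases hp : p = q
  · subst hp
    have : t = ⟨(blockIdx i h p.1.1, blockIdx i h p.1.2), Nat.add_lt_add_left p.2 i⟩ :=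
      Subtype.ext (Prod.ext h1 h2)
    simp [blockB, this]
  · have : (⟨(blockIdx i h p.1.1, blockIdx i h p.1.2), Nat.add_lt_add_left p.2 i⟩ : Pairs r) ≠ t := by
      intro e; apply hp
      subst e
      simp [blockIdx, Fin.ext_iff] at h1 h2
      exact Subtype.ext (Prod.ext (Fin.ext h1) (Fin.ext h2))
    simp only [blockB, Function.update_of_ne hp, Function.update_of_ne this]

theorem blockB_update_of_notMem {n r : ℕ} (i : ℕ) (h : i + n ≤ r) (b : Pairs r → B) (t : Pairs r)
    (ht : ∀ q : Pairs n, t.1.1 = blockIdx i h q.1.1 → t.1.2 ≠ blockIdx i h q.1.2) (x : B) :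
    blockB i h (Function.update b t x) = blockB i h b := by
  funext p
  have : (⟨(blockIdx i h p.1.1, blockIdx i h p.1.2), Nat.add_lt_add_left p.2 i⟩ : Pairs r) ≠ t := by
    rintro rfl; exact ht p rfl rfl
  simp only [blockB, Function.update_of_ne this]

theorem contractA_eq_update {m n r : ℕ} (h : m + n = r + 1) (i : Fin m) (x y : A) (a : Fin r → A) :
    contractA h i x a = Function.update (contractA h i y a) i x := by
  funext p
  by_cases hp : p = i
  · subst hp; simp [contractA]
  · simp [contractA, hp]

/-- An index outside the block corresponds to a unique index of the contracted matrix. -/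
theorem contractA_update_of_notMem {m n r : ℕ} (h : m + n = r + 1) (i : Fin m) (l : Fin r)
    (hl : ∀ p : Fin n, blockIdx i (by omega : (i : ℕ) + n ≤ r) p ≠ l) :
    ∃ p : Fin m, ∀ (x : A) (a : Fin r → A) (y : A),
      contractA h i x (Function.update a l y) = Function.update (contractA h i x a) p y := by
  have hl' : (l : ℕ) < i ∨ (i : ℕ) + n ≤ l := by
    by_contra hc
    push Not at hc
    exact hl ⟨l - i, by omega⟩ (Fin.ext (by simp [blockIdx]; omega))
  rcases hl' with hl' | hl'
  · have hm : (l : ℕ) < m := by omega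
    refine ⟨⟨l, hm⟩, fun x a y => funext fun p => ?_⟩
    by_cases hp : (p : ℕ) = l
    · have e1 : p = ⟨l, hm⟩ := Fin.ext hp
      subst e1
      simp [contractA, Fin.lt_def, hl']
    · have e1 : p ≠ ⟨l, hm⟩ := fun e => hp (by rw [e])
      rw [Function.update_of_ne e1]
      simp only [contractA]
      split_ifs with h1 h2
      · rw [Function.update_of_ne]; intro e; exact hp (congrArg Fin.val e)
      · rfl
      · rw [Function.update_of_ne]; intro e
        have := congrArg Fin.val e
        simp only [Fin.lt_def, Fin.ext_iff] at this h1 h2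
        omega
  · have hm : (l : ℕ) + 1 - n < m := by omega
    refine ⟨⟨l + 1 - n, hm⟩, fun x a y => funext fun p => ?_⟩
    by_cases hp : (p : ℕ) = l + 1 - n
    · have e1 : p = ⟨l + 1 - n, hm⟩ := Fin.ext hp
      subst e1
      have h1 : ¬ ((⟨l + 1 - n, hm⟩ : Fin m) < i) := by rw [Fin.lt_def]; simp; omega
      have h2 : (⟨l + 1 - n, hm⟩ : Fin m) ≠ i := by rw [Ne, Fin.ext_iff]; simp; omega
      have h3 : (⟨l + 1 - n + n - 1, by omega⟩ : Fin r) = l := Fin.ext (by simp; omega)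
      simp only [contractA, h1, h2, dif_neg, not_false_eq_true, h3, Function.update_self]
    · have e1 : p ≠ ⟨l + 1 - n, hm⟩ := fun e => hp (by rw [e])
      rw [Function.update_of_ne e1]
      simp only [contractA]
      split_ifs with h1 h2
      · rw [Function.update_of_ne]; intro e
        have := congrArg Fin.val e
        simp only [Fin.lt_def] at this h1
        omega
      · rfl
      · rw [Function.update_of_ne]; intro e
        have := congrArg Fin.val e
        simp only [Fin.lt_def, Fin.ext_iff] at this h1 h2
        omega

theorem contractA_update_of_mem {m n r : ℕ} (h : m + n = r + 1) (i : Fin m) (l : Fin n) (x y : A)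
    (a : Fin r → A) :
    contractA h i x (Function.update a (blockIdx i (by omega : (i : ℕ) + n ≤ r) l) y) =
      contractA h i x a := by
  funext p
  simp only [contractA]
  split_ifs with h1 h2
  · rw [Function.update_of_ne]; intro e
    have := congrArg Fin.val e
    simp only [Fin.lt_def, blockIdx] at this h1
    omega
  · rfl
  · rw [Function.update_of_ne]; intro e
    have := congrArg Fin.val e
    simp only [Fin.lt_def, Fin.ext_iff, blockIdx] at this h1 h2
    omega

theorem prod_update_of_mem [CommRing B] {ι : Type*} [DecidableEq ι] (s : Finset ι) (b : ι → B) (t : ι)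
    (ht : t ∈ s) (y : B) :
    ∏ u ∈ s, Function.update b t y u = y * ∏ u ∈ s.erase t, b u := by
  rw [← Finset.mul_prod_erase s _ ht, Function.update_self]
  congr 1
  exact Finset.prod_congr rfl fun u hu => Function.update_of_ne (Finset.ne_of_mem_erase hu) _ _

theorem prod_update_of_notMem [CommRing B] {ι : Type*} [DecidableEq ι] (s : Finset ι) (b : ι → B) (t : ι)
    (ht : t ∉ s) (y : B) : ∏ u ∈ s, Function.update b t y u = ∏ u ∈ s, b u :=
  Finset.prod_congr rfl fun u hu => Function.update_of_ne (by rintro rfl; exact ht hu) _ _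

/-- A position whose row and column are not both in the block contributes to a unique entry of
the contracted matrix. -/
theorem contractB_update_of_notMem [CommRing B] {m n r : ℕ} (h : m + n = r + 1) (i : Fin m) (t : Pairs r)
    (ht : squash i n t.1.1 ≠ squash i n t.1.2) (b : Pairs r → B) :
    ∃ (q : Pairs m) (c : B), ∀ y : B,
      contractB n i (Function.update b t y) = Function.update (contractB n i b) q (y * c) := by
  have hlt : (t.1.1 : ℕ) < t.1.2 := t.2
  have h1 : squash i n t.1.1 < m := by unfold squash; split_ifs <;> omega
  have h2 : squash i n t.1.2 < m := by unfold squash; split_ifs <;> omega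
  have h3 : squash i n t.1.1 < squash i n t.1.2 := by
    unfold squash at ht ⊢; split_ifs at ht ⊢ <;> omega
  refine ⟨⟨(⟨_, h1⟩, ⟨_, h2⟩), h3⟩,
    ∏ u ∈ (Finset.univ.filter fun u : Pairs r =>
      squash i n u.1.1 = squash i n t.1.1 ∧ squash i n u.1.2 = squash i n t.1.2).erase t, b u,
    fun y => funext fun q => ?_⟩
  by_cases hq : q = ⟨(⟨_, h1⟩, ⟨_, h2⟩), h3⟩
  · subst hq
    rw [Function.update_self]
    exact prod_update_of_mem _ b t (by simp) y
  · rw [Function.update_of_ne hq]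
    refine prod_update_of_notMem _ b t (fun hm => hq ?_) y
    simp only [Finset.mem_filter] at hm
    exact Subtype.ext (Prod.ext (Fin.ext hm.2.1.symm) (Fin.ext hm.2.2.symm))

theorem contractB_update_of_mem [CommRing B] {m n r : ℕ} (i : Fin m) (t : Pairs r)
    (ht : squash i n t.1.1 = squash i n t.1.2) (b : Pairs r → B) (y : B) :
    contractB n i (Function.update b t y) = contractB n i b := by
  funext q
  refine prod_update_of_notMem _ b t (fun hm => ?_) y
  simp only [Finset.mem_filter] at hm
  have : (q.1.1 : ℕ) < q.1.2 := q.2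
  omega

end BlockLemmas

section Operations

variable {k A B : Type*} [Field k] [Ring A] [Algebra k A] [CommRing B] [Algebra k B]

theorem apply_contractA_add {m n r : ℕ} (h : m + n = r + 1) (i : Fin m) (f : Cochain k A B m)
    (x y : A) (a : Fin r → A) (b : Pairs m → B) : f (contractA h i (x + y) a) b =
      f (contractA h i x a) b + f (contractA h i y a) b := by
  rw [contractA_eq_update h i (x + y) 0, contractA_eq_update h i x 0, contractA_eq_update h i y 0,
    MultilinearMap.map_update_add, add_apply]

theorem apply_contractA_smul {m n r : ℕ} (h : m + n = r + 1) (i : Fin m) (f : Cochain k A B m)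
    (c : k) (x : A) (a : Fin r → A) (b : Pairs m → B) : f (contractA h i (c • x) a) b =
      c • f (contractA h i x a) b := by
  rw [contractA_eq_update h i (c • x) 0, contractA_eq_update h i x 0,
    MultilinearMap.map_update_smul, smul_apply]

theorem IsMulti.contract {m n r : ℕ} (h : m + n = r + 1) (i : Fin m) (f : Cochain k A B m)
    {G : (Fin n → A) → (Pairs n → B) → A} (hG : IsMulti k G) :
    IsMulti k (fun (a : Fin r → A) (b : Pairs r → B) =>
      f (contractA h i (G (blockA i (by omega : (i : ℕ) + n ≤ r) a) (blockB i (by omega) b)) a)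
        (contractB n i b)) := by
  have hb : (i : ℕ) + n ≤ r := by omega
  have keyA : ∀ (a : Fin r → A) (b : Pairs r → B) (l : Fin r),
      (∃ l' : Fin n, ∃ c : Fin m → A, ∀ y,
        contractA h i (G (blockA i hb (Function.update a l y)) (blockB i hb b))
          (Function.update a l y) =
        Function.update c i (G (Function.update (blockA i hb a) l' y) (blockB i hb b))) ∨
      (∃ p : Fin m, ∃ c : Fin m → A, ∀ y,
        contractA h i (G (blockA i hb (Function.update a l y)) (blockB i hb b))
          (Function.update a l y) = Function.update c p y) := by
    intro a b l
    by_cases hl : ∀ p : Fin n, blockIdx i hb p ≠ l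
    · obtain ⟨p, hp⟩ := contractA_update_of_notMem (A := A) h i l hl
      refine Or.inr ⟨p, contractA h i (G (blockA i hb a) (blockB i hb b)) a, fun y => ?_⟩
      rw [blockA_update_of_notMem i hb a l hl, hp]
    · push Not at hl
      obtain ⟨l', rfl⟩ := hl
      refine Or.inl ⟨l', contractA h i 0 a, fun y => ?_⟩
      rw [contractA_update_of_mem, blockA_update_of_mem, contractA_eq_update h i _ 0]
  have keyB : ∀ (a : Fin r → A) (b : Pairs r → B) (t : Pairs r),
      (∃ q : Pairs n, ∀ y,
        blockB i hb (Function.update b t y) = Function.update (blockB i hb b) q y ∧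
        contractB n i (Function.update b t y) = contractB n i b) ∨
      (∃ (q : Pairs m) (c : B), ∀ y,
        blockB i hb (Function.update b t y) = blockB i hb b ∧
        contractB n i (Function.update b t y) = Function.update (contractB n i b) q (y * c)) := by
    intro a b t
    have hlt : (t.1.1 : ℕ) < t.1.2 := t.2
    by_cases ht : squash i n t.1.1 = squash i n t.1.2
    · have h12 : (i : ℕ) ≤ t.1.1 ∧ (t.1.2 : ℕ) < i + n := by
        unfold squash at ht; split_ifs at ht <;> omega
      refine Or.inl ⟨⟨(⟨t.1.1 - i, by omega⟩, ⟨t.1.2 - i, by omega⟩),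
        by simp only [Fin.lt_def]; omega⟩, fun y => ⟨?_, contractB_update_of_mem i t ht b y⟩⟩
      apply blockB_update_of_mem
      · apply Fin.ext; simp [blockIdx]; omega
      · apply Fin.ext; simp [blockIdx]; omega
    · obtain ⟨q, c, hq⟩ := contractB_update_of_notMem h i t ht b
      refine Or.inr ⟨q, c, fun y => ⟨?_, hq y⟩⟩
      apply blockB_update_of_notMem
      intro p e1 e2
      apply ht
      rw [e1, e2]
      simp [squash, blockIdx]
  constructor
  · intro a b l x y
    rcases keyA a b l with ⟨l', c, hc⟩ | ⟨p, c, hc⟩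
    · simp only [hc, hG.addA, MultilinearMap.map_update_add, add_apply]
    · simp only [hc, MultilinearMap.map_update_add, add_apply]
  · intro a b l s x
    rcases keyA a b l with ⟨l', c, hc⟩ | ⟨p, c, hc⟩
    · simp only [hc, hG.smulA, MultilinearMap.map_update_smul, smul_apply]
    · simp only [hc, MultilinearMap.map_update_smul, smul_apply]
  · intro a b t x y
    rcases keyB a b t with ⟨q, hq⟩ | ⟨q, c, hq⟩
    · simp only [fun y => (hq y).1, fun y => (hq y).2, hG.addB]
      simp only [apply_contractA_add]
    · simp only [fun y => (hq y).1, fun y => (hq y).2, add_mul, MultilinearMap.map_update_add]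
  · intro a b t s x
    rcases keyB a b t with ⟨q, hq⟩ | ⟨q, c, hq⟩
    · simp only [fun y => (hq y).1, fun y => (hq y).2, hG.smulB]
      simp only [apply_contractA_smul]
    · simp only [fun y => (hq y).1, fun y => (hq y).2, smul_mul_assoc,
        MultilinearMap.map_update_smul]

/-- `f ∘_i g` for `f ∈ C^m`, `g ∈ C^n`, `0 ≤ i ≤ m - 1`, an element of `C^r`, `r = m + n - 1`:
the block on the indices `i, …, i+n-1` is contracted and its diagonal entry becomes the value of
`g` on that block; then `f` is applied. -/
def compAt {m n r : ℕ} (h : m + n = r + 1) (i : Fin m) :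
    Cochain k A B m →ₗ[k] Cochain k A B n →ₗ[k] Cochain k A B r :=
  LinearMap.mk₂ k
    (fun f g => Cochain.ofFun
      (fun a b =>
        f (contractA h i (g (blockA i (by omega : (i : ℕ) + n ≤ r) a) (blockB i (by omega) b)) a)
          (contractB n i b))
      (IsMulti.contract h i f g.isMulti))
    (fun f f' g => by ext a b; simp)
    (fun c f g => by ext a b; simp)
    (fun f g g' => by
      ext a b
      simp only [Cochain.ofFun_apply, add_apply]
      simp only [apply_contractA_add])
    (fun c f g => by
      ext a b
      simp only [Cochain.ofFun_apply, smul_apply]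
      simp only [apply_contractA_smul])

end Operations

section Differential

variable {k A B : Type*} [Field k] [Ring A] [Algebra k A] [CommRing B] [Algebra k B]

theorem prod_update_inj {ι κ : Type*} [DecidableEq ι] [Fintype κ] [DecidableEq κ] (e : κ → ι)
    (he : Function.Injective e) (b : ι → B) (l : κ) (y : B) :
    ∏ u, Function.update b (e l) y (e u) = y * ∏ u ∈ Finset.univ.erase l, b (e u) := by
  have : ∀ u, Function.update b (e l) y (e u) = Function.update (fun u => b (e u)) l y u := by
    intro u
    by_cases hu : u = l
    · subst hu; simp
    · rw [Function.update_of_ne hu, Function.update_of_ne (he.ne hu)]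
  simp only [this]
  exact prod_update_of_mem _ _ l (Finset.mem_univ l) y

/-- The positions `(0, 1), …, (0, n)` in a matrix of size `r = n + 1`. -/
def firstRow {n r : ℕ} (h : n + 1 = r) (l : Fin n) : Pairs r :=
  ⟨(⟨0, by omega⟩, ⟨l + 1, by omega⟩), by simp only [Fin.lt_def]; omega⟩

/-- The positions `(0, n), …, (n - 1, n)` in a matrix of size `r = n + 1`. -/
def lastCol {n r : ℕ} (h : n + 1 = r) (l : Fin n) : Pairs r :=
  ⟨(⟨l, by omega⟩, ⟨n, by omega⟩), by simp only [Fin.lt_def]; omega⟩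

theorem firstRow_injective {n r : ℕ} (h : n + 1 = r) : Function.Injective (firstRow h) := by
  intro x y e
  have := congrArg (fun p : Pairs r => (p.1.2 : ℕ)) e
  simp only [firstRow] at this
  exact Fin.ext (by omega)

theorem lastCol_injective {n r : ℕ} (h : n + 1 = r) : Function.Injective (lastCol h) := by
  intro x y e
  have := congrArg (fun p : Pairs r => (p.1.1 : ℕ)) e
  simp only [lastCol] at this
  exact Fin.ext this

theorem isMulti_first {n r : ℕ} (ε : B →ₐ[k] A) (h : n + 1 = r) (f : Cochain k A B n) :
    IsMulti k (fun (a : Fin r → A) (b : Pairs r → B) =>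
      a ⟨0, by omega⟩ * ε (∏ l : Fin n, b (firstRow h l)) *
        f (blockA 1 (by omega : 1 + n ≤ r) a) (blockB 1 (by omega) b)) := by
  have h1 : 1 + n ≤ r := by omega
  have keyA : ∀ l : Fin r, (l = ⟨0, by omega⟩ ∧ ∀ p : Fin n, blockIdx 1 h1 p ≠ l) ∨
      (∃ l' : Fin n, l = blockIdx 1 h1 l' ∧ (⟨0, by omega⟩ : Fin r) ≠ l) := by
    intro l
    by_cases hl : (l : ℕ) = 0
    · refine Or.inl ⟨Fin.ext hl, fun p e => ?_⟩
      have := congrArg Fin.val e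
      simp only [blockIdx] at this; omega
    · refine Or.inr ⟨⟨l - 1, by omega⟩, Fin.ext (by simp only [blockIdx]; omega), fun e => hl ?_⟩
      exact (congrArg Fin.val e).symm
  have keyB : ∀ (b : Pairs r → B) (t : Pairs r),
      (∃ c : B, ∀ y, ∏ l : Fin n, Function.update b t y (firstRow h l) = y * c ∧
        blockB 1 h1 (Function.update b t y) = blockB 1 h1 b) ∨
      (∃ q : Pairs n, ∀ y, ∏ l : Fin n, Function.update b t y (firstRow h l) =
        ∏ l : Fin n, b (firstRow h l) ∧
        blockB 1 h1 (Function.update b t y) = Function.update (blockB 1 h1 b) q y) := by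
    intro b t
    have hlt : (t.1.1 : ℕ) < t.1.2 := t.2
    by_cases ht : (t.1.1 : ℕ) = 0
    · have e : t = firstRow h ⟨t.1.2 - 1, by omega⟩ :=
        Subtype.ext (Prod.ext (Fin.ext ht) (Fin.ext (by simp only [firstRow]; omega)))
      refine Or.inl ⟨∏ u ∈ Finset.univ.erase ⟨t.1.2 - 1, by omega⟩, b (firstRow h u), fun y => ⟨?_, ?_⟩⟩
      · conv_lhs => rw [e]
        exact prod_update_inj _ (firstRow_injective h) b _ y
      · apply blockB_update_of_notMem
        intro q e1
        rw [e1] at ht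
        simp [blockIdx] at ht
    · refine Or.inr ⟨⟨(⟨t.1.1 - 1, by omega⟩, ⟨t.1.2 - 1, by omega⟩),
        by simp only [Fin.lt_def]; omega⟩, fun y => ⟨?_, ?_⟩⟩
      · refine Finset.prod_congr rfl fun l _ => Function.update_of_ne (fun e => ht ?_) _ _
        rw [← e]; rfl
      · apply blockB_update_of_mem
        · apply Fin.ext; simp only [blockIdx]; omega
        · apply Fin.ext; simp only [blockIdx]; omega
  constructor
  · intro a b l x y
    rcases keyA l with ⟨rfl, hl⟩ | ⟨l', rfl, hl⟩
    · simp only [blockA_update_of_notMem _ _ _ _ hl, Function.update_self, add_mul]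
    · simp only [blockA_update_of_mem, Function.update_of_ne hl, MultilinearMap.map_update_add,
        add_apply, mul_add]
  · intro a b l c x
    rcases keyA l with ⟨rfl, hl⟩ | ⟨l', rfl, hl⟩
    · simp only [blockA_update_of_notMem _ _ _ _ hl, Function.update_self, smul_mul_assoc]
    · simp only [blockA_update_of_mem, Function.update_of_ne hl, MultilinearMap.map_update_smul,
        smul_apply, mul_smul_comm]
  · intro a b t x y
    rcases keyB b t with ⟨c, hc⟩ | ⟨q, hq⟩
    · simp only [fun y => (hc y).1, fun y => (hc y).2, add_mul, mul_add, map_add]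
    · simp only [fun y => (hq y).1, fun y => (hq y).2, MultilinearMap.map_update_add, mul_add]
  · intro a b t s x
    rcases keyB b t with ⟨c, hc⟩ | ⟨q, hq⟩
    · simp only [fun y => (hc y).1, fun y => (hc y).2, smul_mul_assoc, mul_smul_comm, map_smul]
    · simp only [fun y => (hq y).1, fun y => (hq y).2, MultilinearMap.map_update_smul,
        mul_smul_comm]

theorem isMulti_last {n r : ℕ} (ε : B →ₐ[k] A) (h : n + 1 = r) (f : Cochain k A B n) :
    IsMulti k (fun (a : Fin r → A) (b : Pairs r → B) =>
      f (blockA 0 (by omega : 0 + n ≤ r) a) (blockB 0 (by omega) b) *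
        a ⟨n, by omega⟩ * ε (∏ l : Fin n, b (lastCol h l))) := by
  have h1 : 0 + n ≤ r := by omega
  have keyA : ∀ l : Fin r, (l = ⟨n, by omega⟩ ∧ ∀ p : Fin n, blockIdx 0 h1 p ≠ l) ∨
      (∃ l' : Fin n, l = blockIdx 0 h1 l' ∧ (⟨n, by omega⟩ : Fin r) ≠ l) := by
    intro l
    by_cases hl : (l : ℕ) = n
    · refine Or.inl ⟨Fin.ext hl, fun p e => ?_⟩
      have := congrArg Fin.val e
      simp only [blockIdx] at this; omega
    · refine Or.inr ⟨⟨l, by omega⟩, Fin.ext (by simp only [blockIdx]; omega), fun e => hl ?_⟩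
      exact (congrArg Fin.val e).symm
  have keyB : ∀ (b : Pairs r → B) (t : Pairs r),
      (∃ c : B, ∀ y, ∏ l : Fin n, Function.update b t y (lastCol h l) = y * c ∧
        blockB 0 h1 (Function.update b t y) = blockB 0 h1 b) ∨
      (∃ q : Pairs n, ∀ y, ∏ l : Fin n, Function.update b t y (lastCol h l) =
        ∏ l : Fin n, b (lastCol h l) ∧
        blockB 0 h1 (Function.update b t y) = Function.update (blockB 0 h1 b) q y) := by
    intro b t
    have hlt : (t.1.1 : ℕ) < t.1.2 := t.2
    by_cases ht : (t.1.2 : ℕ) = n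
    · have e : t = lastCol h ⟨t.1.1, by omega⟩ :=
        Subtype.ext (Prod.ext rfl (Fin.ext ht))
      refine Or.inl ⟨∏ u ∈ Finset.univ.erase ⟨t.1.1, by omega⟩, b (lastCol h u), fun y => ⟨?_, ?_⟩⟩
      · conv_lhs => rw [e]
        exact prod_update_inj _ (lastCol_injective h) b _ y
      · apply blockB_update_of_notMem
        intro q _ e1
        rw [e1] at ht
        simp only [blockIdx] at ht
        omega
    · refine Or.inr ⟨⟨(⟨t.1.1, by omega⟩, ⟨t.1.2, by omega⟩), t.2⟩, fun y => ⟨?_, ?_⟩⟩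
      · refine Finset.prod_congr rfl fun l _ => Function.update_of_ne (fun e => ht ?_) _ _
        rw [← e]; rfl
      · apply blockB_update_of_mem
        · apply Fin.ext; simp only [blockIdx]; omega
        · apply Fin.ext; simp only [blockIdx]; omega
  constructor
  · intro a b l x y
    rcases keyA l with ⟨rfl, hl⟩ | ⟨l', rfl, hl⟩
    · simp only [blockA_update_of_notMem _ _ _ _ hl, Function.update_self, add_mul, mul_add]
    · simp only [blockA_update_of_mem, Function.update_of_ne hl, MultilinearMap.map_update_add,
        add_apply, add_mul]
  · intro a b l c x
    rcases keyA l with ⟨rfl, hl⟩ | ⟨l', rfl, hl⟩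
    · simp only [blockA_update_of_notMem _ _ _ _ hl, Function.update_self, smul_mul_assoc,
        mul_smul_comm]
    · simp only [blockA_update_of_mem, Function.update_of_ne hl, MultilinearMap.map_update_smul,
        smul_apply, smul_mul_assoc]
  · intro a b t x y
    rcases keyB b t with ⟨c, hc⟩ | ⟨q, hq⟩
    · simp only [fun y => (hc y).1, fun y => (hc y).2, add_mul, mul_add, map_add]
    · simp only [fun y => (hq y).1, fun y => (hq y).2, MultilinearMap.map_update_add, add_mul]
  · intro a b t s x
    rcases keyB b t with ⟨c, hc⟩ | ⟨q, hq⟩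
    · simp only [fun y => (hc y).1, fun y => (hc y).2, smul_mul_assoc, mul_smul_comm, map_smul]
    · simp only [fun y => (hq y).1, fun y => (hq y).2, MultilinearMap.map_update_smul,
        smul_mul_assoc]

/-- The diagonal entry `ε(b_{i,i+1}) a_i a_{i+1}` of a matrix in which the rows and columns `i` and
`i + 1` are multiplied; `a`, `b` are the entries of the corresponding `2 × 2` block. -/
def mulEps (ε : B →ₐ[k] A) (a : Fin 2 → A) (b : Pairs 2 → B) : A :=
  ε (b ⟨(0, 1), by decide⟩) * a 0 * a 1

theorem isMulti_mulEps (ε : B →ₐ[k] A) : IsMulti k (mulEps ε) := by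
  have hp : ∀ t : Pairs 2, t = ⟨(0, 1), by decide⟩ := by decide
  constructor
  · intro a b l x y
    fin_cases l <;> simp [mulEps, mul_add, add_mul]
  · intro a b l c x
    fin_cases l <;> simp [mulEps]
  · intro a b t x y
    rw [hp t]; simp [mulEps, add_mul]
  · intro a b t c x
    rw [hp t]; simp [mulEps]

/-- The secondary Hochschild differential `δ^ε_n : C^n → C^r`, `r = n + 1`:
`a_0 ε(∏ b_{0,l}) f(T^1_{n+1}) + ∑_i (-1)^{i+1} f(M_{i,i+1}) + (-1)^{n+1} f(T^0_n) a_n ε(∏ b_{l,n})`,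
where `M_{i,i+1}` results from contracting the block `{i, i+1}` to `ε(b_{i,i+1}) a_i a_{i+1}`. -/
def delta {n r : ℕ} (ε : B →ₐ[k] A) (h : n + 1 = r) : Cochain k A B n →ₗ[k] Cochain k A B r where
  toFun f := Cochain.ofFun
    (fun a b =>
      a ⟨0, by omega⟩ * ε (∏ l : Fin n, b (firstRow h l)) *
          f (blockA 1 (by omega : 1 + n ≤ r) a) (blockB 1 (by omega) b) +
        ∑ i : Fin n, (-1) ^ ((i : ℕ) + 1) *
          f (contractA (by omega : n + 2 = r + 1) i
              (mulEps ε (blockA i (by omega) a) (blockB i (by omega) b)) a)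
            (contractB 2 i b) +
        (-1) ^ (n + 1) * (f (blockA 0 (by omega : 0 + n ≤ r) a) (blockB 0 (by omega) b) *
          a ⟨n, by omega⟩ * ε (∏ l : Fin n, b (lastCol h l))))
    (((isMulti_first ε h f).add
      (IsMulti.sum _ fun i => (IsMulti.contract (by omega) i f (isMulti_mulEps ε)).neg_pow _)).add
      ((isMulti_last ε h f).neg_pow _))
  map_add' f g := by
    ext a b
    simp only [Cochain.ofFun_apply, add_apply, mul_add, add_mul, Finset.sum_add_distrib]
    abel
  map_smul' c f := by
    ext a b
    simp only [Cochain.ofFun_apply, smul_apply, mul_smul_comm, smul_mul_assoc, smul_add,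
      Finset.smul_sum, RingHom.id_apply]

end Differential

section Graded

universe u v

variable (k : Type*) [Field k] (V : ℤ → Type u) [∀ n, AddCommGroup (V n)] [∀ n, Module k (V n)]

/-- A bilinear operation of degree `0` on a `ℤ`-graded vector space: maps `V_m × V_n → V_r` for
`m + n = r`. -/
abbrev GradedOp : Type _ := ∀ m n r : ℤ, m + n = r → (V m →ₗ[k] V n →ₗ[k] V r)

/-- A pre-Lie system: operations `∘_i : V_m × V_n → V_{m+n}`, `0 ≤ i ≤ m`, with
`(f ∘_i g) ∘_j h = (f ∘_j h) ∘_{i+p} g` for `0 ≤ j ≤ i - 1` and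
`(f ∘_i g) ∘_j h = f ∘_i (g ∘_{j-i} h)` for `i ≤ j ≤ i + n`, where `f ∈ V_m`, `g ∈ V_n`, `h ∈ V_p`.
The values of `circ i` on `V_m` for `i` outside `[0, m]` carry no information. -/
structure IsPreLieSystem (circ : ℤ → GradedOp k V) : Prop where
  exchange : ∀ (m n p mn mp s : ℤ) (h₁ : m + n = mn) (h₂ : mn + p = s) (h₃ : m + p = mp)
    (h₄ : mp + n = s) (i j : ℤ), i ≤ m → 0 ≤ j → j ≤ i - 1 →
    ∀ (f : V m) (g : V n) (h : V p),
      circ j mn p s h₂ (circ i m n mn h₁ f g) h = circ (i + p) mp n s h₄ (circ j m p mp h₃ f h) g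
  nest : ∀ (m n p mn np s : ℤ) (h₁ : m + n = mn) (h₂ : mn + p = s) (h₃ : n + p = np)
    (h₄ : m + np = s) (i j : ℤ), 0 ≤ i → i ≤ m → i ≤ j → j ≤ i + n →
    ∀ (f : V m) (g : V n) (h : V p),
      circ j mn p s h₂ (circ i m n mn h₁ f g) h =
        circ i m np s h₄ f (circ (j - i) n p np h₃ g h)

variable {k V}

/-- `f ∘ g = ∑_{i=0}^{m} (-1)^{n i} f ∘_i g` for `f ∈ V_m`, `g ∈ V_n`. -/
noncomputable def totalComp (circ : ℤ → GradedOp k V) : GradedOp k V := fun m n r h =>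
  ∑ i ∈ Finset.Icc 0 m, (n * i).negOnePow • circ i m n r h

/-- `[f, g] = f ∘ g - (-1)^{m n} g ∘ f` for `f ∈ V_m`, `g ∈ V_n`. -/
noncomputable def commBracket (circ : ℤ → GradedOp k V) : GradedOp k V := fun m n r h =>
  totalComp circ m n r h -
    (m * n).negOnePow • (totalComp circ n m r ((add_comm n m).trans h)).flip

/-- A `ℤ`-graded Lie algebra over a field of any characteristic: graded antisymmetry, the graded
Jacobi identity, and the two identities `[x, x] = 0` (`x` of even degree) and `[x, [x, x]] = 0`
(`x` of odd degree), which follow from the former ones if `2` and `3` are invertible. -/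
structure IsGradedLie (br : GradedOp k V) : Prop where
  antisymm : ∀ (m n r : ℤ) (h : m + n = r) (h' : n + m = r) (x : V m) (y : V n),
    br m n r h x y = -((m * n).negOnePow • br n m r h' y x)
  jacobi : ∀ (m n p mn np mp s : ℤ) (h₁ : n + p = np) (h₂ : m + np = s) (h₃ : m + n = mn)
    (h₄ : mn + p = s) (h₅ : m + p = mp) (h₆ : n + mp = s) (x : V m) (y : V n) (z : V p),
    br m np s h₂ x (br n p np h₁ y z) =
      br mn p s h₄ (br m n mn h₃ x y) z +
        (m * n).negOnePow • br n mp s h₆ y (br m p mp h₅ x z)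
  self_even : ∀ (m r : ℤ) (h : m + m = r) (x : V m), Even m → br m m r h x x = 0
  self_odd : ∀ (m r s : ℤ) (h : m + m = r) (h' : m + r = s) (x : V m), Odd m →
    br m r s h' x (br m m r h x x) = 0

end Graded

section Secondary

universe w u v

variable (k : Type w) (A : Type u) (B : Type v) [Field k] [Ring A] [Algebra k A] [CommRing B]
  [Algebra k B]

/-- The cochains `C^n((A,B,ε);A)` for `n ∈ ℤ`; they vanish for `n < 0`. -/
def CochainZ : ℤ → Type (max u v)
  | Int.ofNat n => Cochain k A B n
  | Int.negSucc _ => PUnit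

instance (n : ℤ) : AddCommGroup (CochainZ k A B n) :=
  match n with
  | Int.ofNat n => inferInstanceAs (AddCommGroup (Cochain k A B n))
  | Int.negSucc _ => (inferInstance : AddCommGroup PUnit.{max u v + 1})

instance (n : ℤ) : Module k (CochainZ k A B n) :=
  match n with
  | Int.ofNat n => inferInstanceAs (Module k (Cochain k A B n))
  | Int.negSucc _ => (inferInstance : Module k PUnit.{max u v + 1})

/-- `∘_i : C^m × C^n → C^r`, `r = m + n - 1`, for integers `m, n`; it is `compAt` for `m, n, r ≥ 0` and
`0 ≤ i ≤ m - 1`, and set to `0` otherwise. -/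
def compZ (i : ℤ) : ∀ m n r : ℤ, m + n = r + 1 →
    (CochainZ k A B m →ₗ[k] CochainZ k A B n →ₗ[k] CochainZ k A B r)
  | Int.ofNat m, Int.ofNat n, Int.ofNat r, h =>
    if hi : 0 ≤ i ∧ i < m then
      (compAt (Int.ofNat_inj.1 h) ⟨i.toNat, by omega⟩ :
        Cochain k A B m →ₗ[k] Cochain k A B n →ₗ[k] Cochain k A B r)
    else 0
  | _, _, _, _ => 0

/-- `V_m = C^{m+1}((A,B,ε);A)`, which is `0` for `m < -1`. -/
abbrev ShiftedCochain (m : ℤ) : Type (max u v) := CochainZ k A B (m + 1)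

/-- The operations `∘_i : V_m × V_n → V_{m+n}`. -/
def circ (i : ℤ) : GradedOp k (ShiftedCochain k A B) := fun m n r h =>
  compZ k A B i (m + 1) (n + 1) (r + 1) (by omega)

variable {k A B}

/-- The differential `C^n → C^r`, `r = n + 1`, for integers `n`. -/
def deltaZ (ε : B →ₐ[k] A) : ∀ n r : ℤ, n + 1 = r → (CochainZ k A B n →ₗ[k] CochainZ k A B r)
  | Int.ofNat n, Int.ofNat r, h =>
    (delta ε (Int.ofNat_inj.1 h) : Cochain k A B n →ₗ[k] Cochain k A B r)
  | _, _, _ => 0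

/-- The cocycles in `C^n`. -/
def cocycles (ε : B →ₐ[k] A) (n : ℤ) : Submodule k (CochainZ k A B n) :=
  LinearMap.ker (deltaZ ε n (n + 1) rfl)

/-- The coboundaries in `C^n`. -/
def coboundaries (ε : B →ₐ[k] A) (n : ℤ) : Submodule k (CochainZ k A B n) :=
  LinearMap.range (deltaZ ε (n - 1) n (sub_add_cancel n 1))

/-- The secondary Hochschild cohomology `H^n((A,B,ε);A)`. -/
abbrev Cohomology (ε : B →ₐ[k] A) (n : ℤ) : Type (max u v) :=
  cocycles ε n ⧸ (coboundaries ε n).submoduleOf (cocycles ε n)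

/-- The cohomology with `H^{m+1}` placed in degree `m`. -/
abbrev ShiftedCohomology (ε : B →ₐ[k] A) (m : ℤ) : Type (max u v) := Cohomology ε (m + 1)

/-- The class of a cocycle. -/
def cls (ε : B →ₐ[k] A) (n : ℤ) (f : CochainZ k A B n) (hf : f ∈ cocycles ε n) : Cohomology ε n :=
  Submodule.Quotient.mk ⟨f, hf⟩

end Secondary

end SecHoch

/-!
Contractions of a tensor matrix at disjoint blocks commute and nested contractions compose, so the
cochains form a pre-Lie system. For any such system the associator `(f ∘ g) ∘ h - f ∘ (g ∘ h)` is
the sum of the terms in which `g` and `h` are inserted at disjoint places of `f` (Gerstenhaber). It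
is therefore graded symmetric in `g` and `h`, and this implies the graded Jacobi identity of the
commutator.

Because the image of `ε` is central, the differential is `δ = -[·, μ]` for the cochain
`μ(a₁, a₂, b) = ε(b) a₁ a₂` of degree `1`. The Jacobi identity with `μ` as third argument reads
`[f, [g, μ]] = [[f, g], μ] ± [g, [f, μ]]`: brackets of cocycles are cocycles, and the bracket of a
cocycle `f` with a coboundary `[g, μ]` is the coboundary `[[f, g], μ]`.
-/

namespace SecHoch

section Blocks

variable {A B : Type*}

/-- The position in a matrix of size `r` of the entry at `q` of its submatrix on the indices
`i, …, i+n-1`. -/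
def blockPair {n r : ℕ} (i : ℕ) (h : i + n ≤ r) (q : Pairs n) : Pairs r :=
  ⟨(blockIdx i h q.1.1, blockIdx i h q.1.2), Nat.add_lt_add_left q.2 i⟩

theorem Pairs.ext_val {n : ℕ} {s t : Pairs n} (h₁ : (s.1.1 : ℕ) = t.1.1)
    (h₂ : (s.1.2 : ℕ) = t.1.2) : s = t :=
  Subtype.ext (Prod.ext (Fin.ext h₁) (Fin.ext h₂))

theorem blockPair_injective {n r : ℕ} (i : ℕ) (h : i + n ≤ r) :
    Function.Injective (blockPair i h) := by
  intro s t hst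
  simp only [blockPair, blockIdx, Subtype.mk.injEq, Prod.mk.injEq, Fin.mk.injEq] at hst
  exact Pairs.ext_val (by omega) (by omega)

theorem exists_blockPair_eq {n r : ℕ} {i : ℕ} (h : i + n ≤ r) {t : Pairs r}
    (hi : i ≤ t.1.1) (ht : (t.1.2 : ℕ) < i + n) : ∃ q, blockPair i h q = t := by
  have : (t.1.1 : ℕ) < t.1.2 := t.2
  refine ⟨⟨(⟨t.1.1 - i, by omega⟩, ⟨t.1.2 - i, by omega⟩), by rw [Fin.mk_lt_mk]; omega⟩, ?_⟩
  exact Pairs.ext_val (by simp only [blockPair, blockIdx]; omega)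
    (by simp only [blockPair, blockIdx]; omega)

theorem blockA_blockA {n p r : ℕ} {i j l : ℕ} (hi : i + n ≤ r) (hj : j + p ≤ n) (hl : l + p ≤ r)
    (e : l = i + j) (a : Fin r → A) : blockA j hj (blockA i hi a) = blockA l hl a := by
  subst e
  funext t
  simp only [blockA, blockIdx, Nat.add_assoc]

theorem blockB_blockB {n p r : ℕ} {i j l : ℕ} (hi : i + n ≤ r) (hj : j + p ≤ n) (hl : l + p ≤ r)
    (e : l = i + j) (b : Pairs r → B) : blockB j hj (blockB i hi b) = blockB l hl b := by
  subst e
  funext t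
  simp only [blockB, blockIdx, Nat.add_assoc]

end Blocks

section Squash

theorem squash_mono (i n : ℕ) : Monotone (squash i n) := by
  intro s t hst
  unfold squash
  split_ifs <;> omega

theorem squash_add (i j n l : ℕ) : squash (i + j) n (i + l) = i + squash j n l := by
  unfold squash
  split_ifs <;> omega

theorem squash_lt {m n r : ℕ} (h : m + n = r + 1) (i : Fin m) (l : Fin r) :
    squash i n l < m := by
  unfold squash
  split_ifs <;> omega

theorem squash_squash_comm {i i' j p : ℕ} (hji : j < i) (hi' : i' + 1 = i + p) (n l : ℕ) :
    squash i n (squash j p l) = squash j p (squash i' n l) := by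
  unfold squash
  split_ifs <;> omega

theorem squash_squash_nest {i j n p np : ℕ} (hij : i ≤ j) (hjn : j < i + n)
    (hnp : n + p = np + 1) (l : ℕ) : squash i n (squash j p l) = squash i np l := by
  unfold squash
  split_ifs <;> omega

end Squash

section ContractDiagonal

variable {A : Type*}

theorem blockA_contractA_of_lt {m n p s : ℕ} (h : m + p = s + 1) {j : Fin m} {i i' : ℕ}
    (hj : j < i) (hi : i + n ≤ m) (hi' : i' + n ≤ s) (e : i + p = i' + 1) (x : A)
    (a : Fin s → A) : blockA i hi (contractA h j x a) = blockA i' hi' a := by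
  funext l
  simp only [blockA, contractA]
  rw [dif_neg (by simp only [blockIdx, Fin.lt_def]; omega),
    dif_neg (by simp only [blockIdx, Fin.ext_iff]; omega)]
  exact congrArg a (Fin.ext (by simp only [blockIdx]; omega))

theorem blockA_contractA_of_le {m n p s : ℕ} (h : m + n = s + 1) {i : Fin m} {j : ℕ}
    (hj : j + p ≤ i) (hj' : j + p ≤ m) (hs : j + p ≤ s) (x : A) (a : Fin s → A) :
    blockA j hj' (contractA h i x a) = blockA j hs a := by
  funext l
  simp only [blockA, contractA]
  rw [dif_pos (by simp only [blockIdx, Fin.lt_def]; omega)]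
  rfl

theorem blockA_contractA {m n p np s : ℕ} (h : m + p = s + 1) {j : Fin m} {j' : Fin n} {i : ℕ}
    (hi : i + n ≤ m) (e : (j : ℕ) = i + j') (hnp : n + p = np + 1) (hs : i + np ≤ s) (x : A)
    (a : Fin s → A) :
    blockA i hi (contractA h j x a) = contractA hnp j' x (blockA i hs a) := by
  funext l
  have blockIdx_val : (blockIdx i hi l : ℕ) = i + l := rfl
  simp only [blockA, contractA, Fin.lt_def, Fin.ext_iff, blockIdx_val]
  split_ifs <;> first | rfl | omega | exact congrArg a (Fin.ext (by simp only [blockIdx]; omega))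

theorem contractA_contractA_comm {m n p mn mp s : ℕ} (hmn : m + n = mn + 1) (hs : mn + p = s + 1)
    (hmp : m + p = mp + 1) (hs' : mp + n = s + 1) {i j : Fin m} (hji : (j : ℕ) < i) {j' : Fin mn}
    (ej : (j' : ℕ) = j) {i' : Fin mp} (ei : (i' : ℕ) + 1 = i + p) (x y : A) (a : Fin s → A) :
    contractA hmn i y (contractA hs j' x a) = contractA hmp j x (contractA hs' i' y a) := by
  funext l
  simp only [contractA, Fin.lt_def, Fin.ext_iff]
  split_ifs <;> first | rfl | omega | exact congrArg a (Fin.ext (by simp only; omega))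

theorem contractA_contractA_nest {m n p mn np s : ℕ} (hmn : m + n = mn + 1) (hs : mn + p = s + 1)
    (hnp : n + p = np + 1) (hs' : m + np = s + 1) {i : Fin m} {j : Fin mn}
    (hij : (i : ℕ) ≤ j) (hjn : (j : ℕ) < i + n) (x y : A) (a : Fin s → A) :
    contractA hmn i y (contractA hs j x a) = contractA hs' i y a := by
  funext l
  simp only [contractA, Fin.lt_def, Fin.ext_iff]
  split_ifs <;> first | rfl | omega | exact congrArg a (Fin.ext (by simp only; omega))

end ContractDiagonal

section ContractOffDiagonal

variable {B : Type*} [CommRing B]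

theorem contractB_apply_eq_prod {κ : Type*} {m n r : ℕ} {i : Fin m} {q : Pairs m} (s : Finset κ)
    {e : κ → Pairs r} (he : Function.Injective e)
    (hs : ∀ t : Pairs r, squash i n t.1.1 = (q.1.1 : ℕ) ∧ squash i n t.1.2 = (q.1.2 : ℕ) ↔
      ∃ l ∈ s, e l = t) (b : Pairs r → B) :
    contractB n i b q = ∏ l ∈ s, b (e l) := by
  refine Eq.trans ?_ (Finset.prod_map s ⟨e, he⟩ b)
  refine Finset.prod_congr (Finset.ext fun t => ?_) fun _ _ => rfl
  simp only [Finset.mem_filter, Finset.mem_univ, true_and, Finset.mem_map,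
    Function.Embedding.coeFn_mk, hs]

theorem contractB_apply_eq_single {m n r : ℕ} {i : Fin m} {q : Pairs m} (t : Pairs r)
    (ht : ∀ u : Pairs r, squash i n u.1.1 = (q.1.1 : ℕ) ∧ squash i n u.1.2 = (q.1.2 : ℕ) ↔
      (u.1.1 : ℕ) = t.1.1 ∧ (u.1.2 : ℕ) = t.1.2) (b : Pairs r → B) :
    contractB n i b q = b t := by
  rw [contractB_apply_eq_prod {()} (e := fun _ => t) (Function.injective_of_subsingleton _),
    Finset.prod_singleton]
  intro u
  rw [ht u]
  exact ⟨fun h => ⟨(), Finset.mem_singleton_self _, Pairs.ext_val h.1.symm h.2.symm⟩,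
    by rintro ⟨_, -, rfl⟩; exact ⟨rfl, rfl⟩⟩

theorem blockB_contractB_of_lt {m n p s : ℕ} {j : Fin m} {i i' : ℕ}
    (hj : j < i) (hi : i + n ≤ m) (hi' : i' + n ≤ s) (e : i + p = i' + 1) (b : Pairs s → B) :
    blockB i hi (contractB p j b) = blockB i' hi' b := by
  funext q
  refine contractB_apply_eq_single (blockPair i' hi' q) (fun u => ?_) b
  simp only [squash, blockPair, blockIdx]
  split_ifs <;> omega

theorem blockB_contractB_of_le {m n p s : ℕ} {i : Fin m} {j : ℕ}
    (hj : j + p ≤ i) (hj' : j + p ≤ m) (hs : j + p ≤ s) (b : Pairs s → B) :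
    blockB j hj' (contractB n i b) = blockB j hs b := by
  funext q
  refine contractB_apply_eq_single (blockPair j hs q) (fun u => ?_) b
  simp only [squash, blockPair, blockIdx]
  split_ifs <;> omega

theorem blockB_contractB {m n p np s : ℕ} {j : Fin m} {j' : Fin n} {i : ℕ}
    (hi : i + n ≤ m) (e : (j : ℕ) = i + j') (hnp : n + p = np + 1) (hs : i + np ≤ s)
    (b : Pairs s → B) :
    blockB i hi (contractB p j b) = contractB p j' (blockB i hs b) := by
  funext q
  refine contractB_apply_eq_prod _ (blockPair_injective i hs) (fun t => ?_) b
  have : (q.1.1 : ℕ) < q.1.2 := q.2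
  have squash_blockIdx (l : Fin np) : squash j p (blockIdx i hs l) = i + squash j' p l :=
    e ▸ squash_add i j' p l
  simp only [Finset.mem_filter, Finset.mem_univ, true_and]
  constructor
  · intro ht
    obtain ⟨u, rfl⟩ := exists_blockPair_eq hs (t := t)
      (by simp only [squash, blockIdx] at ht; split_ifs at ht <;> omega)
      (by simp only [squash, blockIdx] at ht; split_ifs at ht <;> omega)
    simp only [blockPair, squash_blockIdx] at ht
    exact ⟨u, ⟨Nat.add_left_cancel ht.1, Nat.add_left_cancel ht.2⟩, rfl⟩
  · rintro ⟨u, hu, rfl⟩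
    simp only [blockPair, squash_blockIdx, hu]
    exact ⟨rfl, rfl⟩

theorem contractB_contractB_apply {m n p mn s : ℕ} (hs : mn + p = s + 1) (i : Fin m) (j : Fin mn)
    (b : Pairs s → B) (q : Pairs m) :
    contractB n i (contractB p j b) q = ∏ t : Pairs s with
      squash i n (squash j p t.1.1) = (q.1.1 : ℕ) ∧
        squash i n (squash j p t.1.2) = (q.1.2 : ℕ), b t := by
  unfold contractB
  rw [← Finset.prod_biUnion]
  · refine Finset.prod_congr (Finset.ext fun t => ?_) fun _ _ => rfl
    simp only [Finset.mem_biUnion, Finset.mem_filter, Finset.mem_univ, true_and]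
    refine ⟨?_, fun ht => ?_⟩
    · rintro ⟨u, hu, h₁, h₂⟩
      rwa [h₁, h₂]
    · have hlt : squash j p t.1.1 < squash j p t.1.2 :=
        (squash_mono i n).reflect_lt (by rw [ht.1, ht.2]; exact q.2)
      exact ⟨⟨(⟨_, squash_lt hs j t.1.1⟩, ⟨_, squash_lt hs j t.1.2⟩), hlt⟩, ht, rfl, rfl⟩
  · intro u _ v _ huv
    refine Finset.disjoint_left.2 fun t htu htv => huv ?_
    simp only [Finset.mem_filter, Finset.mem_univ, true_and] at htu htv
    exact Pairs.ext_val (htu.1.symm.trans htv.1) (htu.2.symm.trans htv.2)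

theorem contractB_contractB_comm {m n p mn mp s : ℕ} (hs : mn + p = s + 1)
    (hs' : mp + n = s + 1) {i j : Fin m} (hji : (j : ℕ) < i) {j' : Fin mn}
    (ej : (j' : ℕ) = j) {i' : Fin mp} (ei : (i' : ℕ) + 1 = i + p) (b : Pairs s → B) :
    contractB n i (contractB p j' b) = contractB p j (contractB n i' b) := by
  funext q
  simp only [contractB_contractB_apply hs, contractB_contractB_apply hs', ej,
    squash_squash_comm hji ei]

theorem contractB_contractB_nest {m n p mn np s : ℕ} (hs : mn + p = s + 1)
    (hnp : n + p = np + 1) {i : Fin m} {j : Fin mn}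
    (hij : (i : ℕ) ≤ j) (hjn : (j : ℕ) < i + n) (b : Pairs s → B) :
    contractB n i (contractB p j b) = contractB np i b := by
  funext q
  simp only [contractB_contractB_apply hs, squash_squash_nest hij hjn hnp]
  rfl

end ContractOffDiagonal

section CompAt

variable {k A B : Type*} [Field k] [Ring A] [Algebra k A] [CommRing B] [Algebra k B]

theorem compAt_apply {m n r : ℕ} (h : m + n = r + 1) (i : Fin m) (f : Cochain k A B m)
    (g : Cochain k A B n) (a : Fin r → A) (b : Pairs r → B) :
    compAt h i f g a b =
      f (contractA h i (g (blockA i (by omega : (i : ℕ) + n ≤ r) a) (blockB i (by omega) b)) a)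
        (contractB n i b) := rfl

theorem compAt_exchange {m n p mn mp s : ℕ} (hmn : m + n = mn + 1) (hs : mn + p = s + 1)
    (hmp : m + p = mp + 1) (hs' : mp + n = s + 1) {i j : Fin m} (hji : (j : ℕ) < i) {j' : Fin mn}
    (ej : (j' : ℕ) = j) {i' : Fin mp} (ei : (i' : ℕ) + 1 = i + p) (f : Cochain k A B m)
    (g : Cochain k A B n) (h : Cochain k A B p) :
    compAt hs j' (compAt hmn i f g) h = compAt hs' i' (compAt hmp j f h) g := by
  ext a b
  obtain ⟨j', hj'⟩ := j'
  obtain rfl : j' = j := ej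
  simp only [compAt_apply]
  rw [contractB_contractB_comm hs hs' hji rfl ei,
    contractA_contractA_comm hmn hs hmp hs' hji rfl ei,
    blockA_contractA_of_lt hs (i' := i') hji (by omega) (by omega) (by omega),
    blockB_contractB_of_lt (j := ⟨j, hj'⟩) (i' := i') hji (by omega) (by omega) (by omega),
    blockA_contractA_of_le hs' (by omega) (by omega) (by omega),
    blockB_contractB_of_le (by omega) (by omega) (by omega)]

theorem compAt_nest {m n p mn np s : ℕ} (hmn : m + n = mn + 1) (hs : mn + p = s + 1)
    (hnp : n + p = np + 1) (hs' : m + np = s + 1) {i : Fin m} {j : Fin mn} {j' : Fin n}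
    (ej : (j : ℕ) = i + j') (f : Cochain k A B m) (g : Cochain k A B n) (h : Cochain k A B p) :
    compAt hs j (compAt hmn i f g) h = compAt hs' i f (compAt hnp j' g h) := by
  ext a b
  simp only [compAt_apply]
  rw [contractB_contractB_nest hs hnp (by omega) (by omega),
    contractA_contractA_nest hmn hs hnp hs' (by omega) (by omega),
    blockA_contractA hs (by omega) ej hnp (by omega),
    blockB_contractB (by omega) ej hnp (by omega),
    blockA_blockA (by omega) (by omega) (by omega) ej,
    blockB_blockB (by omega) (by omega) (by omega) ej]

end CompAt

section CompZ

variable {k A B : Type*} [Field k] [Ring A] [Algebra k A] [CommRing B] [Algebra k B]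

theorem CochainZ.subsingleton {n : ℤ} (hn : n < 0) : Subsingleton (CochainZ k A B n) :=
  match n, hn with
  | Int.negSucc _, _ => inferInstanceAs (Subsingleton PUnit)

theorem CochainZ.eq_zero {n : ℤ} (hn : n < 0) (x : CochainZ k A B n) : x = 0 :=
  (CochainZ.subsingleton hn).elim _ _

theorem compZ_natCast {i m n r : ℕ} (h : m + n = r + 1) (h' : (m : ℤ) + n = r + 1) (hi : i < m)
    (f : CochainZ k A B m) (g : CochainZ k A B n) :
    compZ k A B (i : ℤ) (m : ℤ) (n : ℤ) (r : ℤ) h' f g =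
      (show CochainZ k A B r from compAt (k := k) (A := A) (B := B) h ⟨i, hi⟩ f g) := by
  have compZ_eq : compZ k A B (i : ℤ) (Int.ofNat m) (Int.ofNat n) (Int.ofNat r) h' =
      (compAt h ⟨i, hi⟩ : Cochain k A B m →ₗ[k] Cochain k A B n →ₗ[k] Cochain k A B r) :=
    dif_pos (show 0 ≤ (i : ℤ) ∧ (i : ℤ) < m by omega)
  exact LinearMap.congr_fun (LinearMap.congr_fun compZ_eq f) g

theorem compZ_exchange {m n p mn mp s : ℤ} (hmn : m + n = mn + 1) (hs : mn + p = s + 1)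
    (hmp : m + p = mp + 1) (hs' : mp + n = s + 1) {i j i' : ℤ} (hi : i < m) (hj : 0 ≤ j)
    (hji : j < i) (ei : i' + 1 = i + p) (f : CochainZ k A B m) (g : CochainZ k A B n)
    (h : CochainZ k A B p) :
    compZ k A B j mn p s hs (compZ k A B i m n mn hmn f g) h =
      compZ k A B i' mp n s hs' (compZ k A B j m p mp hmp f h) g := by
  rcases lt_or_ge n 0 with hn | hn
  · rw [CochainZ.eq_zero hn g]; simp only [map_zero, LinearMap.zero_apply]
  rcases lt_or_ge p 0 with hp | hp
  · rw [CochainZ.eq_zero hp h]; simp only [map_zero, LinearMap.zero_apply]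
  lift m to ℕ using by omega
  lift n to ℕ using hn
  lift p to ℕ using hp
  lift mn to ℕ using by omega
  lift mp to ℕ using by omega
  lift s to ℕ using by omega
  lift j to ℕ using hj
  lift i to ℕ using by omega
  lift i' to ℕ using by omega
  rw [compZ_natCast (by omega) hmn (by omega), compZ_natCast (by omega) hs (by omega),
    compZ_natCast (by omega) hmp (by omega), compZ_natCast (by omega) hs' (by omega)]
  refine compAt_exchange (k := k) (A := A) (B := B) _ _ _ _ ?_ ?_ ?_ _ _ _ <;> dsimp only <;> omega

theorem compZ_nest {m n p mn np s : ℤ} (hmn : m + n = mn + 1) (hs : mn + p = s + 1)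
    (hnp : n + p = np + 1) (hs' : m + np = s + 1) {i j j' : ℤ} (hi : 0 ≤ i) (him : i < m)
    (hij : i ≤ j) (hjn : j < i + n) (ej : j' = j - i) (f : CochainZ k A B m)
    (g : CochainZ k A B n) (h : CochainZ k A B p) :
    compZ k A B j mn p s hs (compZ k A B i m n mn hmn f g) h =
      compZ k A B i m np s hs' f (compZ k A B j' n p np hnp g h) := by
  rcases lt_or_ge p 0 with hp | hp
  · rw [CochainZ.eq_zero hp h]; simp only [map_zero]
  have hn : 0 < n := by omega
  lift m to ℕ using by omega
  lift n to ℕ using hn.le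
  lift p to ℕ using hp
  lift mn to ℕ using by omega
  lift np to ℕ using by omega
  lift s to ℕ using by omega
  lift j to ℕ using by omega
  lift i to ℕ using hi
  lift j' to ℕ using by omega
  rw [compZ_natCast (by omega) hmn (by omega), compZ_natCast (by omega) hs (by omega),
    compZ_natCast (by omega) hnp (by omega), compZ_natCast (by omega) hs' (by omega)]
  exact compAt_nest (k := k) (A := A) (B := B) _ _ _ _ (by simp only; omega) _ _ _

variable (k A B) in
theorem isPreLieSystem_circ : IsPreLieSystem k (ShiftedCochain k A B) (circ k A B) where
  exchange _ _ _ _ _ _ _ _ _ _ _ _ hi hj hji _ _ _ :=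
    compZ_exchange _ _ _ _ (by omega) hj (by omega) (by omega) _ _ _
  nest _ _ _ _ _ _ _ _ _ _ _ _ hi him hij hjn _ _ _ :=
    compZ_nest _ _ _ _ hi (by omega) hij (by omega) rfl _ _ _

end CompZ

section PreLie

universe u

variable {k : Type*} [Field k] {V : ℤ → Type u} [∀ n, AddCommGroup (V n)] [∀ n, Module k (V n)]

section TotalComposition

variable (circ : ℤ → GradedOp k V)

theorem totalComp_apply {m n r : ℤ} (h : m + n = r) (f : V m) (g : V n) :
    totalComp circ m n r h f g =
      ∑ i ∈ Finset.Icc 0 m, (n * i).negOnePow • circ i m n r h f g := by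
  simp only [totalComp, LinearMap.sum_apply, Units.smul_def, LinearMap.smul_apply]

theorem commBracket_apply {m n r : ℤ} (h : m + n = r) (h' : n + m = r) (f : V m) (g : V n) :
    commBracket circ m n r h f g =
      totalComp circ m n r h f g - (m * n).negOnePow • totalComp circ n m r h' g f := by
  simp only [commBracket, LinearMap.sub_apply, Units.smul_def, LinearMap.smul_apply,
    LinearMap.flip_apply]

/-- The signed term of `(f ∘ g) ∘ h` in which `g` is inserted into `f` at the place `x.1`, and `h`
into the result at the place `x.2`. -/
def insertionTerm {m n p mn s : ℤ} (h₁ : m + n = mn) (h₂ : mn + p = s) (f : V m) (g : V n)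
    (h : V p) (x : ℤ × ℤ) : V s :=
  (n * x.1 + p * x.2).negOnePow • circ x.2 mn p s h₂ (circ x.1 m n mn h₁ f g) h

/-- The part of `(f ∘ g) ∘ h` in which `h` is inserted to the left of `g`. -/
noncomputable def leftInsertions {m n p mn s : ℤ} (h₁ : m + n = mn) (h₂ : mn + p = s) (f : V m)
    (g : V n) (h : V p) : V s :=
  ∑ x ∈ Finset.Icc 0 m ×ˢ Finset.Icc 0 m with x.2 < x.1, insertionTerm circ h₁ h₂ f g h x

/-- The associator `(f ∘ g) ∘ h - f ∘ (g ∘ h)` of the total composition. -/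
noncomputable def totalAssociator {m n p mn np s : ℤ} (h₁ : m + n = mn) (h₂ : mn + p = s)
    (h₃ : n + p = np) (h₄ : m + np = s) (f : V m) (g : V n) (h : V p) : V s :=
  totalComp circ mn p s h₂ (totalComp circ m n mn h₁ f g) h -
    totalComp circ m np s h₄ f (totalComp circ n p np h₃ g h)

theorem totalComp_totalComp_left {m n p mn s : ℤ} (h₁ : m + n = mn) (h₂ : mn + p = s) (f : V m)
    (g : V n) (h : V p) :
    totalComp circ mn p s h₂ (totalComp circ m n mn h₁ f g) h =
      ∑ x ∈ Finset.Icc 0 m ×ˢ Finset.Icc 0 mn, insertionTerm circ h₁ h₂ f g h x := by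
  simp only [Finset.sum_product, totalComp_apply, map_sum, LinearMap.sum_apply, Finset.smul_sum,
    insertionTerm, Units.smul_def, map_zsmul, LinearMap.smul_apply, smul_smul, ← Units.val_mul,
    ← Int.negOnePow_add]

theorem totalComp_totalComp_right {m n p np s : ℤ} (h₁ : n + p = np) (h₂ : m + np = s) (f : V m)
    (g : V n) (h : V p) :
    totalComp circ m np s h₂ f (totalComp circ n p np h₁ g h) =
      ∑ x ∈ Finset.Icc 0 m ×ˢ Finset.Icc 0 n, (p * x.2 + np * x.1).negOnePow •
        circ x.1 m np s h₂ f (circ x.2 n p np h₁ g h) := by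
  simp only [Finset.sum_product_right, totalComp_apply, map_sum, Finset.smul_sum, Units.smul_def,
    map_zsmul, smul_smul, ← Units.val_mul, ← Int.negOnePow_add]

theorem commBracket_jacobiator {m n p mn np mp s : ℤ}
    (h₁ : n + p = np) (h₂ : m + np = s) (h₃ : m + n = mn) (h₄ : mn + p = s) (h₅ : m + p = mp)
    (h₆ : n + mp = s) (h₁' : p + n = np) (h₂' : np + m = s) (h₃' : n + m = mn) (h₄' : p + mn = s)
    (h₅' : p + m = mp) (h₆' : mp + n = s) (x : V m) (y : V n) (z : V p) :
    commBracket circ m np s h₂ x (commBracket circ n p np h₁ y z) -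
        commBracket circ mn p s h₄ (commBracket circ m n mn h₃ x y) z -
        (m * n).negOnePow • commBracket circ n mp s h₆ y (commBracket circ m p mp h₅ x z) =
      -(totalAssociator circ h₃ h₄ h₁ h₂ x y z -
          (n * p).negOnePow • totalAssociator circ h₅ h₆' h₁' h₂ x z y) +
        (m * n).negOnePow • (totalAssociator circ h₃' h₄ h₅ h₆ y x z -
          (m * p).negOnePow • totalAssociator circ h₁ h₂' h₅' h₆ y z x) -
        ((m * p).negOnePow * (n * p).negOnePow) • (totalAssociator circ h₅' h₆' h₃ h₄' z x y -
          (m * n).negOnePow • totalAssociator circ h₁' h₂' h₃' h₄' z y x) := by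
  simp only [commBracket_apply circ h₁ h₁', commBracket_apply circ h₂ h₂',
    commBracket_apply circ h₃ h₃', commBracket_apply circ h₄ h₄', commBracket_apply circ h₅ h₅',
    commBracket_apply circ h₆ h₆', totalAssociator, map_sub, LinearMap.sub_apply,
    Units.smul_def, map_zsmul, LinearMap.smul_apply]
  subst h₁ h₃ h₅
  simp only [mul_add, add_mul, Int.negOnePow_add, Units.val_mul, mul_comm n m]
  rcases Int.units_eq_one_or (m * n).negOnePow with hmn | hmn <;>
  rcases Int.units_eq_one_or (m * p).negOnePow with hmp | hmp <;>
  rcases Int.units_eq_one_or (n * p).negOnePow with hnp | hnp <;>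
  · simp only [hmn, hmp, hnp, Units.val_one, Units.val_neg]
    module

end TotalComposition

variable {circ : ℤ → GradedOp k V}

theorem sum_insertionTerm_left {m n p mn s : ℤ} (hn : -1 ≤ n) (h₁ : m + n = mn) (h₂ : mn + p = s)
    (f : V m) (g : V n) (h : V p) :
    ∑ x ∈ Finset.Icc 0 m ×ˢ Finset.Icc 0 mn with x.2 < x.1, insertionTerm circ h₁ h₂ f g h x =
      leftInsertions circ h₁ h₂ f g h := by
  refine Finset.sum_congr (Finset.ext fun x => ?_) fun _ _ => rfl
  simp only [Finset.mem_filter, Finset.mem_product, Finset.mem_Icc]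
  omega

namespace IsPreLieSystem

variable (H : IsPreLieSystem k V circ)

include H

theorem insertionTerm_exchange {m n p mn mp s i j : ℤ} (h₁ : m + n = mn) (h₂ : mn + p = s)
    (h₃ : m + p = mp) (h₄ : mp + n = s) (hi : i ≤ m) (hj : 0 ≤ j) (hji : j < i)
    (f : V m) (g : V n) (h : V p) :
    insertionTerm circ h₁ h₂ f g h (j, i + n) =
      (n * p).negOnePow • insertionTerm circ h₃ h₄ f h g (i, j) := by
  rw [insertionTerm, insertionTerm, smul_smul, ← Int.negOnePow_add,
    H.exchange m p n mp mn s h₃ h₄ h₁ h₂ i j hi hj (by omega)]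
  congr 2
  ring

theorem insertionTerm_nest {m n p mn np s i j : ℤ} (h₁ : m + n = mn) (h₂ : mn + p = s)
    (h₃ : n + p = np) (h₄ : m + np = s) (hi : 0 ≤ i) (him : i ≤ m) (hj : 0 ≤ j) (hjn : j ≤ n)
    (f : V m) (g : V n) (h : V p) :
    insertionTerm circ h₁ h₂ f g h (i, i + j) =
      (p * j + np * i).negOnePow • circ i m np s h₄ f (circ j n p np h₃ g h) := by
  rw [insertionTerm, H.nest m n p mn np s h₁ h₂ h₃ h₄ i (i + j) hi him (by omega) (by omega)]
  subst h₃
  simp only [add_sub_cancel_left]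
  congr 2
  ring

theorem sum_insertionTerm_right {m n p mn mp s : ℤ} (hn : -1 ≤ n) (h₁ : m + n = mn)
    (h₂ : mn + p = s) (h₃ : m + p = mp) (h₄ : mp + n = s) (f : V m) (g : V n) (h : V p) :
    ∑ x ∈ Finset.Icc 0 m ×ˢ Finset.Icc 0 mn with x.1 + n < x.2, insertionTerm circ h₁ h₂ f g h x =
      (n * p).negOnePow • leftInsertions circ h₃ h₄ f h g := by
  rw [leftInsertions, Finset.smul_sum]
  symm
  refine Finset.sum_bij' (fun x _ => (x.2, x.1 + n)) (fun x _ => (x.2 - n, x.1)) ?_ ?_ ?_ ?_ ?_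
  all_goals
    intro x hx
    simp only [Finset.mem_filter, Finset.mem_product, Finset.mem_Icc] at hx ⊢
  · omega
  · omega
  · rw [add_sub_cancel_right]
  · rw [sub_add_cancel]
  · exact (H.insertionTerm_exchange h₁ h₂ h₃ h₄ (by omega) (by omega) (by omega) f g h).symm

theorem sum_insertionTerm_nested {m n p mn np s : ℤ} (h₁ : m + n = mn) (h₂ : mn + p = s)
    (h₃ : n + p = np) (h₄ : m + np = s) (f : V m) (g : V n) (h : V p) :
    ∑ x ∈ Finset.Icc 0 m ×ˢ Finset.Icc 0 mn with x.1 ≤ x.2 ∧ x.2 ≤ x.1 + n,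
        insertionTerm circ h₁ h₂ f g h x =
      totalComp circ m np s h₄ f (totalComp circ n p np h₃ g h) := by
  rw [totalComp_totalComp_right]
  symm
  refine Finset.sum_bij' (fun x _ => (x.1, x.1 + x.2)) (fun x _ => (x.1, x.2 - x.1)) ?_ ?_ ?_ ?_ ?_
  all_goals
    intro x hx
    simp only [Finset.mem_filter, Finset.mem_product, Finset.mem_Icc] at hx ⊢
  · omega
  · omega
  · rw [add_sub_cancel_left]
  · rw [add_sub_cancel]
  · exact (H.insertionTerm_nest h₁ h₂ h₃ h₄ (by omega) (by omega) (by omega) (by omega) f g h).symm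

theorem totalAssociator_eq_leftInsertions {m n p mn np mp s : ℤ} (hn : -1 ≤ n) (h₁ : m + n = mn)
    (h₂ : mn + p = s) (h₃ : n + p = np) (h₄ : m + np = s) (h₅ : m + p = mp) (h₆ : mp + n = s)
    (f : V m) (g : V n) (h : V p) :
    totalAssociator circ h₁ h₂ h₃ h₄ f g h =
      leftInsertions circ h₁ h₂ f g h + (n * p).negOnePow • leftInsertions circ h₅ h₆ f h g := by
  have not_left_iff (x : ℤ × ℤ) : ¬x.2 < x.1 ∧ ¬x.1 + n < x.2 ↔ x.1 ≤ x.2 ∧ x.2 ≤ x.1 + n := by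
    omega
  have not_left_and_right_iff (x : ℤ × ℤ) : ¬x.2 < x.1 ∧ x.1 + n < x.2 ↔ x.1 + n < x.2 := by
    omega
  rw [totalAssociator, sub_eq_iff_eq_add, totalComp_totalComp_left,
    ← Finset.sum_filter_add_sum_filter_not _ (fun x : ℤ × ℤ => x.2 < x.1),
    ← Finset.sum_filter_add_sum_filter_not (Finset.filter (fun x => ¬x.2 < x.1) _)
      (fun x : ℤ × ℤ => x.1 + n < x.2), Finset.filter_filter, Finset.filter_filter]
  simp only [not_left_iff, not_left_and_right_iff]
  rw [sum_insertionTerm_left hn, H.sum_insertionTerm_right hn h₁ h₂ h₅ h₆,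
    H.sum_insertionTerm_nested h₁ h₂ h₃ h₄, add_assoc]

theorem totalAssociator_rightSymm (hV : ∀ n < -1, Subsingleton (V n)) {m n p mn np mp s : ℤ}
    (h₁ : m + n = mn) (h₂ : mn + p = s) (h₃ : n + p = np) (h₃' : p + n = np) (h₄ : m + np = s)
    (h₅ : m + p = mp) (h₆ : mp + n = s) (f : V m) (g : V n) (h : V p) :
    totalAssociator circ h₁ h₂ h₃ h₄ f g h =
      (n * p).negOnePow • totalAssociator circ h₅ h₆ h₃' h₄ f h g := by
  rcases lt_or_ge n (-1) with hn | hn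
  · have := hV n hn
    simp only [totalAssociator, Subsingleton.elim g 0, map_zero, LinearMap.zero_apply, sub_zero,
      smul_zero]
  rcases lt_or_ge p (-1) with hp | hp
  · have := hV p hp
    simp only [totalAssociator, Subsingleton.elim h 0, map_zero, LinearMap.zero_apply, sub_zero,
      smul_zero]
  rw [H.totalAssociator_eq_leftInsertions hn h₁ h₂ h₃ h₄ h₅ h₆,
    H.totalAssociator_eq_leftInsertions hp h₅ h₆ h₃' h₄ h₁ h₂, smul_add, smul_smul,
    mul_comm p n, Int.units_mul_self, one_smul, add_comm]

theorem isGradedLie_commBracket (hV : ∀ n < -1, Subsingleton (V n)) :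
    IsGradedLie (commBracket circ) where
  antisymm m n r h h' x y := by
    rw [commBracket_apply circ h h', commBracket_apply circ h' h, smul_sub, smul_smul,
      mul_comm n m, Int.units_mul_self, one_smul, neg_sub]
  jacobi m n p mn np mp s h₁ h₂ h₃ h₄ h₅ h₆ x y z := by
    have h₁' : p + n = np := by omega
    have h₂' : np + m = s := by omega
    have h₃' : n + m = mn := by omega
    have h₅' : p + m = mp := by omega
    have h₆' : mp + n = s := by omega
    rw [← sub_eq_zero, ← sub_sub,
      commBracket_jacobiator circ h₁ h₂ h₃ h₄ h₅ h₆ h₁' h₂' h₃' (by omega) h₅' h₆',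
      H.totalAssociator_rightSymm hV h₃ h₄ h₁ h₁' h₂ h₅ h₆',
      H.totalAssociator_rightSymm hV h₃' h₄ h₅ h₅' h₆ h₁ h₂',
      H.totalAssociator_rightSymm hV h₅' h₆' h₃ h₃' (by omega) h₁' h₂']
    simp only [sub_self, neg_zero, smul_zero, add_zero]
  self_even m r h x hm := by
    rw [commBracket_apply circ h h, Int.negOnePow_even _ (hm.mul_left m), one_smul, sub_self]
  self_odd m r s h h' x hm := by
    have hr : Even (m * r) := h ▸ (Even.add_self m).mul_left m
    have assoc_add_assoc := H.totalAssociator_rightSymm hV h ((add_comm r m).trans h') h h h' h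
      ((add_comm r m).trans h') x x x
    rw [Int.negOnePow_odd _ (hm.mul hm), Units.neg_smul, one_smul, eq_neg_iff_add_eq_zero,
      totalAssociator] at assoc_add_assoc
    rw [commBracket_apply circ h' ((add_comm r m).trans h'), commBracket_apply circ h h,
      Int.negOnePow_even _ hr, Int.negOnePow_odd _ (hm.mul hm), Units.neg_smul, one_smul,
      sub_neg_eq_add, one_smul, map_add, map_add, LinearMap.add_apply, ← neg_eq_zero,
      ← assoc_add_assoc]
    abel

end IsPreLieSystem

end PreLie

section Multiplication

variable {k A B : Type*} [Field k] [Ring A] [Algebra k A] [CommRing B] [Algebra k B]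

/-- The multiplication `(a₁, a₂, b) ↦ ε(b) a₁ a₂` as a cochain in `C^2`. -/
def mulCochain (ε : B →ₐ[k] A) : Cochain k A B 2 :=
  Cochain.ofFun (mulEps ε) (isMulti_mulEps ε)

/-- The multiplication `mulCochain ε` as an element of `V_1`; the differential is
`f ↦ -[f, mulShifted ε]`. -/
def mulShifted (ε : B →ₐ[k] A) : ShiftedCochain k A B 1 := mulCochain ε

theorem contractB_one_firstRow {n r : ℕ} (h : n + 1 = r) (b : Pairs r → B) :
    contractB (m := 2) n 1 b ⟨(0, 1), by decide⟩ = ∏ l : Fin n, b (firstRow h l) := by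
  refine contractB_apply_eq_prod Finset.univ (firstRow_injective h) (fun t => ⟨fun ht => ?_, ?_⟩) b
  · have : (t.1.1 : ℕ) < t.1.2 := t.2
    have row_eq_zero : (t.1.1 : ℕ) = 0 := by
      have squash_row := ht.1
      simp only [squash, Fin.val_one, Fin.val_zero] at squash_row
      split_ifs at squash_row <;> omega
    exact ⟨⟨t.1.2 - 1, by omega⟩, Finset.mem_univ _,
      Pairs.ext_val row_eq_zero.symm (by simp only [firstRow]; omega)⟩
  · rintro ⟨l, -, rfl⟩
    exact ⟨if_pos Nat.zero_lt_one,
      (if_neg (Nat.le_add_left 1 l).not_gt).trans (if_pos (by simp only [firstRow]; omega))⟩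

theorem contractB_zero_lastCol {n r : ℕ} (h : n + 1 = r) (b : Pairs r → B) :
    contractB (m := 2) n 0 b ⟨(0, 1), by decide⟩ = ∏ l : Fin n, b (lastCol h l) := by
  refine contractB_apply_eq_prod Finset.univ (lastCol_injective h) (fun t => ⟨fun ht => ?_, ?_⟩) b
  · have : (t.1.1 : ℕ) < t.1.2 := t.2
    have col_eq : (t.1.2 : ℕ) = n := by
      have squash_col := ht.2
      simp only [squash, Fin.val_one, Fin.val_zero] at squash_col
      split_ifs at squash_col <;> omega
    exact ⟨⟨t.1.1, by omega⟩, Finset.mem_univ _, Pairs.ext_val rfl col_eq.symm⟩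
  · rintro ⟨l, -, rfl⟩
    exact ⟨(if_neg (Nat.not_lt_zero l)).trans (if_pos (by simp only [lastCol]; omega)),
      by simp [lastCol, squash]⟩

theorem compAt_one_mulCochain_apply (ε : B →ₐ[k] A) {n r : ℕ} (h : n + 1 = r)
    (f : Cochain k A B n) (a : Fin r → A) (b : Pairs r → B) :
    compAt (by omega) 1 (mulCochain ε) f a b =
      ε (∏ l : Fin n, b (firstRow h l)) * a ⟨0, by omega⟩ *
        f (blockA 1 (by omega) a) (blockB 1 (by omega) b) := by
  rw [← contractB_one_firstRow h]
  rfl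

theorem compAt_zero_mulCochain_apply (ε : B →ₐ[k] A) {n r : ℕ} (h : n + 1 = r)
    (f : Cochain k A B n) (a : Fin r → A) (b : Pairs r → B) :
    compAt (by omega) 0 (mulCochain ε) f a b =
      ε (∏ l : Fin n, b (lastCol h l)) * f (blockA 0 (by omega) a) (blockB 0 (by omega) b) *
        a ⟨n, by omega⟩ := by
  have last_index : (⟨n, by omega⟩ : Fin r) = ⟨1 + n - 1, by omega⟩ :=
    Fin.ext (Nat.add_sub_cancel_left 1 n).symm
  rw [← contractB_zero_lastCol h, last_index]
  rfl

theorem delta_eq_compAt (ε : B →ₐ[k] A) (hε : ∀ β : B, ε β ∈ Subalgebra.center k A) {n r : ℕ}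
    (h : n + 1 = r) (f : Cochain k A B n) :
    delta ε h f = compAt (by omega) 1 (mulCochain ε) f -
      ∑ i : Fin n, (i : ℤ).negOnePow • compAt (by omega) i f (mulCochain ε) -
      (n : ℤ).negOnePow • compAt (by omega) 0 (mulCochain ε) f := by
  have mul_eps (β : B) (x : A) : x * ε β = ε β * x := Subalgebra.mem_center_iff.1 (hε β) x
  ext a b
  simp only [sub_apply, sum_apply, Units.smul_def, smul_apply, zsmul_eq_mul,
    Int.cast_negOnePow_natCast, compAt_one_mulCochain_apply ε h, compAt_zero_mulCochain_apply ε h]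
  simp only [delta, LinearMap.coe_mk, AddHom.coe_mk, Cochain.ofFun_apply, mul_eps, pow_succ,
    mul_neg, mul_one, neg_mul, Finset.sum_neg_distrib, ← sub_eq_add_neg, mul_assoc]
  rfl

theorem sum_Icc_zero_eq_sum_fin {M : Type*} [AddCommMonoid M] {m : ℤ} {n : ℕ} (h : m + 1 = n)
    (F : ℤ → M) : ∑ i ∈ Finset.Icc 0 m, F i = ∑ i : Fin n, F (i : ℕ) := by
  rw [Int.Icc_eq_finset_map, sub_zero, h, Int.toNat_natCast, Finset.sum_map, Finset.sum_range]
  simp only [Function.Embedding.trans_apply, Nat.castEmbedding_apply, addLeftEmbedding_apply,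
    zero_add]

theorem deltaZ_eq_compZ (ε : B →ₐ[k] A) (hε : ∀ β : B, ε β ∈ Subalgebra.center k A) {m n r : ℤ}
    (hm : m + 1 = n) (hr : n + 1 = r) (f : CochainZ k A B n) :
    deltaZ ε n r hr f = compZ k A B 1 (1 + 1) n r (by omega) (mulShifted ε) f -
      ∑ i ∈ Finset.Icc 0 m, i.negOnePow • compZ k A B i n (1 + 1) r (by omega) f (mulShifted ε) +
      m.negOnePow • compZ k A B 0 (1 + 1) n r (by omega) (mulShifted ε) f := by
  rcases lt_or_ge n 0 with hn | hn
  · rw [CochainZ.eq_zero hn f]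
    simp only [map_zero, LinearMap.zero_apply, smul_zero, Finset.sum_const_zero, sub_zero, add_zero]
  lift n to ℕ using hn
  lift r to ℕ using by omega
  have mul_comp (i : Fin 2) : compZ k A B (i : ℕ) (1 + 1) n r (by omega) (mulShifted ε) f = _ :=
    compZ_natCast (m := 2) (by omega) (by omega) i.2 (mulCochain ε) f
  have comp_mul (i : Fin n) : compZ k A B (i : ℕ) n (1 + 1) r (by omega) f (mulShifted ε) = _ :=
    compZ_natCast (n := 2) (by omega) (by omega) i.2 f (mulCochain ε)
  have sign : m.negOnePow = -(n : ℤ).negOnePow := by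
    rw [← hm, Int.negOnePow_succ, neg_neg]
  rw [sum_Icc_zero_eq_sum_fin hm, sign, Units.neg_smul, ← sub_eq_add_neg]
  simp only [comp_mul]
  rw [show compZ k A B 1 (1 + 1) n r _ (mulShifted ε) f = _ from mul_comp 1,
    show compZ k A B 0 (1 + 1) n r _ (mulShifted ε) f = _ from mul_comp 0]
  exact delta_eq_compAt ε hε (by omega) f

theorem deltaZ_eq_commBracket (ε : B →ₐ[k] A) (hε : ∀ β : B, ε β ∈ Subalgebra.center k A)
    {m r : ℤ} (h : m + 1 = r) (f : ShiftedCochain k A B m) :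
    deltaZ ε (m + 1) (r + 1) (by omega) f =
      -commBracket (circ k A B) m 1 r h f (mulShifted ε) := by
  rw [commBracket_apply _ h ((add_comm 1 m).trans h), totalComp_apply, totalComp_apply,
    deltaZ_eq_compZ ε hε rfl (by omega), show Finset.Icc (0 : ℤ) 1 = {0, 1} from rfl,
    Finset.sum_pair zero_ne_one]
  simp only [circ, one_mul, mul_one, mul_zero, Int.negOnePow_zero, smul_add, smul_smul, one_smul,
    Int.units_mul_self]
  abel

end Multiplication

section Subquotient

universe u

variable {k : Type*} [Field k] {V : ℤ → Type u} [∀ n, AddCommGroup (V n)] [∀ n, Module k (V n)]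

/-- An operation `br` descends to the subquotients `Z_m / (W_m ∩ Z_m)`: the subspaces `Z` are closed
under it, and it takes values in `W` as soon as one argument is in `Z` and the other one in `W`. -/
structure GradedOp.Descends (br : GradedOp k V) (Z W : ∀ m, Submodule k (V m)) : Prop where
  mem : ∀ {m n r : ℤ} (h : m + n = r) {f : V m} {g : V n}, f ∈ Z m → g ∈ Z n →
    br m n r h f g ∈ Z r
  right_mem : ∀ {m n r : ℤ} (h : m + n = r) {f : V m} {g : V n}, f ∈ Z m → g ∈ W n →
    br m n r h f g ∈ W r
  left_mem : ∀ {m n r : ℤ} (h : m + n = r) {f : V m} {g : V n}, f ∈ W m → g ∈ Z n →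
    br m n r h f g ∈ W r

variable {br : GradedOp k V} {Z W : ∀ m, Submodule k (V m)}

/-- The operation on the subquotients `Z_m / (W_m ∩ Z_m)` induced by an operation that descends to
them. -/
def subquotientOp (D : br.Descends Z W) :
    GradedOp k fun m => Z m ⧸ (W m).submoduleOf (Z m) := fun m n r h =>
  let restricted : Z m →ₗ[k] Z n →ₗ[k] Z r := LinearMap.mk₂ k
    (fun f g => ⟨br m n r h f g, D.mem h f.2 g.2⟩)
    (fun _ _ _ => Subtype.ext (LinearMap.map_add₂ _ _ _ _))
    (fun _ _ _ => Subtype.ext (LinearMap.map_smul₂ _ _ _ _))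
    (fun _ _ _ => Subtype.ext (map_add _ _ _)) (fun _ _ _ => Subtype.ext (map_smul _ _ _))
  ((W m).submoduleOf (Z m)).liftQ
    (((W n).submoduleOf (Z n)).liftQ (restricted.compr₂ ((W r).submoduleOf (Z r)).mkQ).flip
      fun _ hg => LinearMap.ext fun f =>
        (Submodule.Quotient.mk_eq_zero _).2 (D.right_mem h f.2 hg)).flip
    fun _ hf => LinearMap.ext fun y => by
      obtain ⟨g, rfl⟩ := Submodule.Quotient.mk_surjective _ y
      exact (Submodule.Quotient.mk_eq_zero _).2 (D.left_mem h hf g.2)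

theorem subquotientOp_mk (D : br.Descends Z W) {m n r : ℤ} (h : m + n = r) (f : Z m) (g : Z n) :
    subquotientOp D m n r h (Submodule.Quotient.mk f) (Submodule.Quotient.mk g) =
      Submodule.Quotient.mk ⟨br m n r h f g, D.mem h f.2 g.2⟩ := rfl

theorem eq_subquotientOp (D : br.Descends Z W)
    {br' : GradedOp k fun m => Z m ⧸ (W m).submoduleOf (Z m)}
    (hbr' : ∀ {m n r : ℤ} (h : m + n = r) (f : Z m) (g : Z n),
      br' m n r h (Submodule.Quotient.mk f) (Submodule.Quotient.mk g) =
        Submodule.Quotient.mk ⟨br m n r h f g, D.mem h f.2 g.2⟩) :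
    br' = subquotientOp D := by
  funext m n r h
  refine LinearMap.ext fun x => LinearMap.ext fun y => ?_
  obtain ⟨f, rfl⟩ := Submodule.Quotient.mk_surjective _ x
  obtain ⟨g, rfl⟩ := Submodule.Quotient.mk_surjective _ y
  exact hbr' h f g

namespace IsGradedLie

variable (H : IsGradedLie br)

include H

theorem subquotientOp (D : br.Descends Z W) : IsGradedLie (subquotientOp D) where
  antisymm m n r h h' x y := by
    obtain ⟨x, rfl⟩ := Submodule.Quotient.mk_surjective _ x
    obtain ⟨y, rfl⟩ := Submodule.Quotient.mk_surjective _ y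
    exact congrArg Submodule.Quotient.mk (Subtype.ext (H.antisymm m n r h h' x y))
  jacobi m n p mn np mp s h₁ h₂ h₃ h₄ h₅ h₆ x y z := by
    obtain ⟨x, rfl⟩ := Submodule.Quotient.mk_surjective _ x
    obtain ⟨y, rfl⟩ := Submodule.Quotient.mk_surjective _ y
    obtain ⟨z, rfl⟩ := Submodule.Quotient.mk_surjective _ z
    exact congrArg Submodule.Quotient.mk
      (Subtype.ext (H.jacobi m n p mn np mp s h₁ h₂ h₃ h₄ h₅ h₆ x y z))
  self_even m r h x hm := by
    obtain ⟨x, rfl⟩ := Submodule.Quotient.mk_surjective _ x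
    exact congrArg Submodule.Quotient.mk (Subtype.ext (H.self_even m r h x hm))
  self_odd m r s h h' x hm := by
    obtain ⟨x, rfl⟩ := Submodule.Quotient.mk_surjective _ x
    exact congrArg Submodule.Quotient.mk (Subtype.ext (H.self_odd m r s h h' x hm))

theorem bracket_bracket_of_bracket_eq_zero {m n d mn nd md s : ℤ} (h₁ : n + d = nd)
    (h₂ : m + nd = s) (h₃ : m + n = mn) (h₄ : mn + d = s) (h₅ : m + d = md) {x : V m} {c : V d}
    (hx : br m d md h₅ x c = 0) (y : V n) :
    br m nd s h₂ x (br n d nd h₁ y c) = br mn d s h₄ (br m n mn h₃ x y) c := by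
  rw [H.jacobi m n d mn nd md s h₁ h₂ h₃ h₄ h₅ (by omega), hx, map_zero, smul_zero, add_zero]

theorem descends_ker_range {d : ℤ} (c : V d)
    (hZ : ∀ {m : ℤ} (x : V m), x ∈ Z m ↔ br m d (m + d) rfl x c = 0)
    (hW : ∀ {m : ℤ} (x : V m), x ∈ W m ↔
      ∃ (l : ℤ) (h : l + d = m) (y : V l), br l d m h y c = x) :
    br.Descends Z W := by
  have right_mem {m n r : ℤ} (h : m + n = r) {f : V m} {g : V n} (hf : f ∈ Z m) (hg : g ∈ W n) :
      br m n r h f g ∈ W r := by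
    obtain ⟨l, hl, y, rfl⟩ := (hW g).1 hg
    rw [H.bracket_bracket_of_bracket_eq_zero hl h rfl (by omega) rfl ((hZ f).1 hf)]
    exact (hW _).2 ⟨_, _, _, rfl⟩
  refine ⟨fun {m n r} h {f g} hf hg => ?_, right_mem, fun {m n r} h {f g} hf hg => ?_⟩
  · rw [hZ, ← H.bracket_bracket_of_bracket_eq_zero rfl (by omega) h rfl rfl ((hZ f).1 hf),
      (hZ g).1 hg, map_zero]
  · rw [H.antisymm m n r h (by omega), Units.smul_def]
    exact neg_mem (zsmul_mem (right_mem _ hg hf) _)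

end IsGradedLie

end Subquotient

section Cohomology

variable {k A B : Type*} [Field k] [Ring A] [Algebra k A] [CommRing B] [Algebra k B]

variable (k A B) in
theorem isGradedLie_commBracket_circ : IsGradedLie (commBracket (circ k A B)) :=
  (isPreLieSystem_circ k A B).isGradedLie_commBracket fun _ _ =>
    CochainZ.subsingleton (by omega)

theorem mem_cocycles_iff (ε : B →ₐ[k] A) (hε : ∀ β : B, ε β ∈ Subalgebra.center k A) {m : ℤ}
    (f : ShiftedCochain k A B m) :
    f ∈ cocycles ε (m + 1) ↔ commBracket (circ k A B) m 1 (m + 1) rfl f (mulShifted ε) = 0 := by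
  rw [cocycles, LinearMap.mem_ker, deltaZ_eq_commBracket ε hε rfl, neg_eq_zero]

theorem mem_coboundaries_iff_exists_deltaZ (ε : B →ₐ[k] A) {n : ℤ} (f : CochainZ k A B n) :
    f ∈ coboundaries ε n ↔
      ∃ (l : ℤ) (h : l + 1 = n) (u : CochainZ k A B l), deltaZ ε l n h u = f := by
  refine ⟨fun ⟨u, hu⟩ => ⟨n - 1, _, u, hu⟩, ?_⟩
  rintro ⟨l, h, u, rfl⟩
  obtain rfl : l = n - 1 := by omega
  exact LinearMap.mem_range_self _ u

theorem mem_coboundaries_iff (ε : B →ₐ[k] A) (hε : ∀ β : B, ε β ∈ Subalgebra.center k A) {m : ℤ}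
    (f : ShiftedCochain k A B m) :
    f ∈ coboundaries ε (m + 1) ↔ ∃ (l : ℤ) (h : l + 1 = m) (u : ShiftedCochain k A B l),
      commBracket (circ k A B) l 1 m h u (mulShifted ε) = f := by
  rw [mem_coboundaries_iff_exists_deltaZ]
  constructor
  · rintro ⟨l', hl', u, rfl⟩
    obtain ⟨l, rfl⟩ : ∃ l, l' = l + 1 := ⟨l' - 1, by omega⟩
    refine ⟨l, by omega, -u, ?_⟩
    rw [deltaZ_eq_commBracket ε hε (by omega), map_neg, LinearMap.neg_apply]
  · rintro ⟨l, h, u, rfl⟩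
    refine ⟨l + 1, by omega, -u, ?_⟩
    rw [deltaZ_eq_commBracket ε hε h, map_neg, LinearMap.neg_apply, neg_neg]

theorem descends_commBracket (ε : B →ₐ[k] A) (hε : ∀ β : B, ε β ∈ Subalgebra.center k A) :
    GradedOp.Descends (commBracket (circ k A B)) (fun m => cocycles ε (m + 1))
      fun m => coboundaries ε (m + 1) :=
  (isGradedLie_commBracket_circ k A B).descends_ker_range (mulShifted ε) (mem_cocycles_iff ε hε)
    (mem_coboundaries_iff ε hε)

end Cohomology

end SecHoch

theorem mainTheorem2 {k A B : Type*} [Field k] [Ring A] [Algebra k A] [CommRing B] [Algebra k B]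
    (ε : B →ₐ[k] A) (hε : ∀ β : B, ε β ∈ Subalgebra.center k A) :
    SecHoch.IsPreLieSystem k (SecHoch.ShiftedCochain k A B) (SecHoch.circ k A B) ∧
    ∃! br : SecHoch.GradedOp k (SecHoch.ShiftedCohomology ε),
      (∀ (m n r : ℤ) (h : m + n = r)
        (f : SecHoch.ShiftedCochain k A B m) (hf : f ∈ SecHoch.cocycles ε (m + 1))
        (g : SecHoch.ShiftedCochain k A B n) (hg : g ∈ SecHoch.cocycles ε (n + 1)),
        ∃ hfg : SecHoch.commBracket (SecHoch.circ k A B) m n r h f g ∈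
            SecHoch.cocycles ε (r + 1),
          br m n r h (SecHoch.cls ε (m + 1) f hf) (SecHoch.cls ε (n + 1) g hg) =
            SecHoch.cls ε (r + 1)
              (SecHoch.commBracket (SecHoch.circ k A B) m n r h f g) hfg) ∧
      SecHoch.IsGradedLie br := by
  have descends := SecHoch.descends_commBracket ε hε
  refine ⟨SecHoch.isPreLieSystem_circ k A B, SecHoch.subquotientOp descends,
    ⟨fun m n r h f hf g hg => ⟨descends.mem h hf hg,
      SecHoch.subquotientOp_mk descends h ⟨f, hf⟩ ⟨g, hg⟩⟩,
      (SecHoch.isGradedLie_commBracket_circ k A B).subquotientOp descends⟩, ?_⟩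
  rintro br ⟨br_cls, -⟩
  exact SecHoch.eq_subquotientOp descends fun h f g => (br_cls _ _ _ h f f.2 g g.2).2
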